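/- Let $A$ be a complete discrete valuation ring with maximal ideal $\mathfrak m$, perfect residue field $k=A/\mathfrak m$ of characteristic $p>0$, and fraction field $K$ of characteristic $0$. Let $G$ be a finite group. Let $L$ be an object of the derived category $D(A)$ of $A$-modules which has finite tor-dimension (it is represented by a bounded complex of flat $A$-modules) and whose cohomology modules $H^i(L)$ are all finitely generated over $A$, and suppose that $G$ acts on $L$ in $D(A)$, i.e. a group homomorphism $G\to \mathrm{Aut}_{D(A)}(L)$ is given. By functoriality $G$ acts on the vector spaces $H^i(L)\otimes_AK$ and $H^i(L\otimes_A^{\mathbb L}k)$. Call virtual $F[G]$-modules (for a field $F$) the elements of the Grothendieck group of finite-dimensional $F[G]$-modules with respect to short exact sequences. A virtual $k[G]$-module $y$ is called a reduction (modulo $\mathfrak m$) of a virtual $K[G]$-module $x$ if $(x,y)$ is a $\mathbb Z$-linear combination of pairs $([\Lambda\otimes_AK],[\Lambda\otimes_Ak])$, where $\Lambda$ is a finitely generated free $A$-module with $A$-linear $G$-action. Then: (0) all $H^i(L)\otimes_AK$ and $H^i(L\otimes_A^{\mathbb L}k)$, $i\in\mathbb Z$, are finite-dimensional, and all but finitely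 many of them vanish; (1) the virtual $k[G]$-module $\sum_i(-1)^i[H^i(L\otimes_A^{\mathbb L}k)]$ is the reduction of the virtual $K[G]$-module $\sum_i(-1)^i[H^i(L)\otimes_AK]$, i.e. it is a reduction of it, and the only one; (2) (equivalently) for every $p$-regular $g\in G$, i.e. every $g$ of order not divisible by $p$, the value at $g$ of the character of $\sum_i(-1)^i[H^i(L)\otimes_AK]$ equals the value at $g$ of the Brauer character of $\sum_i(-1)^i[H^i(L\otimes_A^{\mathbb L}k)]$: $$\sum_i(-1)^i\,\mathrm{Tr}\bigl(g\mid H^i(L)\otimes_AK\bigr)=\sum_i(-1)^i\sum_{\varepsilon}\widetilde\varepsilon\qquad\text{in }\overline K,$$ where $\overline K$ is an algebraic closure of $K$ and $\varepsilon$ runs through the roots, with multiplicity and in an algebraic closure $\overline k$ of $k$, of the characteristic polynomial of $g$ on $H^i(L\otimes_A^{\mathbb L}k)$, and $\widetilde\varepsilon$ is the Teichmüller lift of $\varepsilon$: the root of unity of order prime to $p$ in $\overline K$ that reduces to $\varepsilon$ under a fixed (arbitrary) $A$-algebra homomorphism from the integral closure of $A$ in $\overline K$ to $\overline k$. -/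

import Mathlib

universe w w' u v

open CategoryTheory IsLocalRing
open scoped TensorProduct

namespace PerfectReduction

section Hereditary

theorem baer_of_divisible {A : Type u} [CommRing A] [IsPrincipalIdealRing A] (Q : Type u) [AddCommGroup Q] [Module A Q]
    (h : ∀ a : A, a ≠ 0 → ∀ q : Q, ∃ q', a • q' = q) : Module.Baer A Q := by
  intro I g
  obtain ⟨a, rfl⟩ := (IsPrincipalIdealRing.principal I).principal
  by_cases ha : a = 0
  · subst ha
    refine ⟨0, fun x hx => ?_⟩
    have h0 : (⟨x, hx⟩ : (Submodule.span A {(0 : A)})) = 0 := Subtype.ext (by simpa using hx)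
    exact (by rw [h0, map_zero, LinearMap.zero_apply] : (0 : A →ₗ[A] Q) x = g ⟨x, hx⟩)
  · obtain ⟨q, hq⟩ := h a ha (g ⟨a, Submodule.mem_span_singleton_self a⟩)
    refine ⟨LinearMap.toSpanSingleton A Q q, fun x hx => ?_⟩
    obtain ⟨b, rfl⟩ := Submodule.mem_span_singleton.1 hx
    have hb : (⟨b • a, hx⟩ : (Submodule.span A {a})) =
        b • ⟨a, Submodule.mem_span_singleton_self a⟩ := rfl
    rw [hb, g.map_smul, ← hq, LinearMap.toSpanSingleton_apply, smul_assoc]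

theorem divisible_of_injective {A : Type u} [CommRing A] [IsDomain A] (Q : Type u) [AddCommGroup Q] [Module A Q]
    [Module.Injective A Q] (a : A) (ha : a ≠ 0) (q : Q) : ∃ q', a • q' = q := by
  obtain ⟨h, hh⟩ := Module.Injective.out (LinearMap.toSpanSingleton A A a)
    (fun x y hxy => by simpa [ha] using hxy) (LinearMap.toSpanSingleton A Q q)
  refine ⟨h 1, ?_⟩
  have := hh 1
  simpa [← map_smul] using this

/-- Submodules of projective modules over a principal ideal domain are projective. -/
theorem projective_submodule {A : Type u} [CommRing A] [IsDomain A] [IsPrincipalIdealRing A]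
    {P : Type u} [AddCommGroup P] [Module A P]
    [Module.Projective A P] (S : Submodule A P) : Module.Projective A S := by
  refine Module.Projective.of_lifting_property'' fun π hπ => ?_
  let M := S →₀ A
  let f : S →ₗ[A] S := LinearMap.id
  obtain ⟨⟨J, hJ, i, hi⟩⟩ := EnoughInjectives.presentation (ModuleCat.of A M)
  have hinj : Function.Injective i := (ModuleCat.mono_iff_injective i).1 hi
  have : Module.Injective A J := Module.injective_module_of_injective_object A J
  let κ : Submodule A J := (LinearMap.ker π).map i.hom
  have hκ : Module.Injective A (J ⧸ κ) := by
    refine (baer_of_divisible _ fun a ha q => ?_).injective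
    obtain ⟨q, rfl⟩ := κ.mkQ_surjective q
    obtain ⟨q', rfl⟩ := divisible_of_injective (A := A) J a ha q
    exact ⟨κ.mkQ q', by simp⟩
  have hker : LinearMap.ker π ≤ LinearMap.ker (κ.mkQ ∘ₗ i.hom) := by
    intro x hx
    simp only [LinearMap.mem_ker, LinearMap.comp_apply, Submodule.mkQ_apply,
      Submodule.Quotient.mk_eq_zero]
    exact Submodule.mem_map_of_mem hx
  let j : S →ₗ[A] J ⧸ κ :=
    (LinearMap.ker π).liftQ (κ.mkQ ∘ₗ i.hom) hker ∘ₗ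
      (π.quotKerEquivOfSurjective hπ).symm.toLinearMap
  have hj (m : M) : j (π m) = κ.mkQ (i m) := by
    have : (π.quotKerEquivOfSurjective hπ).symm (π m) = (LinearMap.ker π).mkQ m := by
      rw [LinearEquiv.symm_apply_eq]; rfl
    simp [j, this]
  obtain ⟨e, he⟩ := Module.Injective.out S.subtype S.injective_subtype (j ∘ₗ f)
  obtain ⟨e', he'⟩ := Module.projective_lifting_property κ.mkQ e κ.mkQ_surjective
  have hmem (s : S) : ∃ m : M, i m = e' s ∧ π m = f s := by
    obtain ⟨m, hm⟩ := hπ (f s)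
    have h1 : κ.mkQ (e' s) = κ.mkQ (i m) := by
      rw [← hj, hm, ← LinearMap.comp_apply, he']
      exact he s
    obtain ⟨x, hx, hx'⟩ := (Submodule.Quotient.eq κ).1 h1
    refine ⟨m + x, ?_, ?_⟩
    · have hx'' : i x = e' s - i m := hx'
      rw [map_add, hx'']; abel
    · rw [map_add, hm, LinearMap.mem_ker.1 hx, add_zero]
  choose t ht ht' using hmem
  refine ⟨⟨⟨t, fun x y => hinj ?_⟩, fun a x => hinj ?_⟩, ?_⟩
  · rw [map_add, ht, ht, ht]; simp
  · simp only [RingHom.id_apply]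
    rw [map_smul, ht, ht]; simp
  · exact LinearMap.ext ht'

end Hereditary

section Resolution

theorem quasiIso_of_elements {A : Type u} [Ring A] {P X : CochainComplex (ModuleCat.{u} A) ℤ}
    (f : P ⟶ X)
    (hinj : ∀ (n : ℤ) (x : P.X (n + 1)), P.d (n + 1) (n + 1 + 1) x = 0 →
      ∀ y : X.X n, X.d n (n + 1) y = f.f (n + 1) x → ∃ x', P.d n (n + 1) x' = x)
    (hsurj : ∀ (n : ℤ) (y : X.X (n + 1)), X.d (n + 1) (n + 1 + 1) y = 0 →
      ∃ x : P.X (n + 1), P.d (n + 1) (n + 1 + 1) x = 0 ∧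
        ∃ z : X.X n, f.f (n + 1) x = y + X.d n (n + 1) z) :
    QuasiIso f := by
  refine ⟨fun m => ?_⟩
  obtain ⟨n, rfl⟩ : ∃ n, m = n + 1 := ⟨m - 1, by ring⟩
  rw [quasiIsoAt_iff_isIso_homologyMap]
  have hex (Y : CochainComplex (ModuleCat.{u} A) ℤ) (z : Y.cycles (n + 1))
      (hz : Y.homologyπ (n + 1) z = 0) : ∃ y : Y.X n, Y.d n (n + 1) y = Y.iCycles (n + 1) z := by
    have h1 : (ShortComplex.mk _ _ (Y.toCycles_comp_homologyπ n (n + 1))).Exact :=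
      ShortComplex.exact_of_g_is_cokernel _
        (Y.homologyIsCokernel n (n + 1) (by simp))
    rw [ShortComplex.moduleCat_exact_iff] at h1
    obtain ⟨y, hy⟩ := h1 z hz
    refine ⟨y, ?_⟩
    rw [← hy]
    exact (ConcreteCategory.congr_hom (Y.toCycles_i n (n + 1)) y).symm
  have hπ (Y : CochainComplex (ModuleCat.{u} A) ℤ) :
      Function.Surjective (Y.homologyπ (n + 1)) :=
    (ModuleCat.epi_iff_surjective _).1 inferInstance
  have hi (Y : CochainComplex (ModuleCat.{u} A) ℤ) :
      Function.Injective (Y.iCycles (n + 1)) :=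
    (ModuleCat.mono_iff_injective _).1 inferInstance
  have hcyc (Y : CochainComplex (ModuleCat.{u} A) ℤ) (y : Y.X (n + 1))
      (hy : Y.d (n + 1) (n + 1 + 1) y = 0) : ∃ z, Y.iCycles (n + 1) z = y := by
    have h1 : (ShortComplex.mk _ _ (Y.iCycles_d (n + 1) (n + 1 + 1))).Exact :=
      ShortComplex.exact_of_f_is_kernel _
        (Y.cyclesIsKernel (n + 1) (n + 1 + 1) (by simp))
    rw [ShortComplex.moduleCat_exact_iff] at h1
    exact h1 y hy
  have hd (Y : CochainComplex (ModuleCat.{u} A) ℤ) (z : Y.cycles (n + 1)) :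
      Y.d (n + 1) (n + 1 + 1) (Y.iCycles (n + 1) z) = 0 :=
    ConcreteCategory.congr_hom (Y.iCycles_d (n + 1) (n + 1 + 1)) z
  have hto (Y : CochainComplex (ModuleCat.{u} A) ℤ) (y : Y.X n) :
      Y.homologyπ (n + 1) (Y.toCycles n (n + 1) y) = 0 :=
    ConcreteCategory.congr_hom (Y.toCycles_comp_homologyπ n (n + 1)) y
  have hti (Y : CochainComplex (ModuleCat.{u} A) ℤ) (y : Y.X n) :
      Y.iCycles (n + 1) (Y.toCycles n (n + 1) y) = Y.d n (n + 1) y :=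
    ConcreteCategory.congr_hom (Y.toCycles_i n (n + 1)) y
  have hci (z : P.cycles (n + 1)) :
      X.iCycles (n + 1) (HomologicalComplex.cyclesMap f (n + 1) z) =
        f.f (n + 1) (P.iCycles (n + 1) z) :=
    ConcreteCategory.congr_hom (HomologicalComplex.cyclesMap_i f (n + 1)) z
  have hnat (z : P.cycles (n + 1)) :
      HomologicalComplex.homologyMap f (n + 1) (P.homologyπ (n + 1) z) =
        X.homologyπ (n + 1) (HomologicalComplex.cyclesMap f (n + 1) z) :=
    ConcreteCategory.congr_hom (HomologicalComplex.homologyπ_naturality f (n + 1)) z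
  rw [ConcreteCategory.isIso_iff_bijective]
  constructor
  · refine (injective_iff_map_eq_zero _).2 fun a ha => ?_
    obtain ⟨z, rfl⟩ := hπ P a
    rw [hnat] at ha
    obtain ⟨y, hy⟩ := hex X _ ha
    rw [hci] at hy
    obtain ⟨x', hx'⟩ := hinj n _ (hd P z) y hy
    have : P.toCycles n (n + 1) x' = z := hi P (by rw [hti, hx'])
    rw [← this, hto]
  · intro b
    obtain ⟨c, rfl⟩ := hπ X b
    obtain ⟨x, hx, z, hz⟩ := hsurj n _ (hd X c)
    obtain ⟨x', rfl⟩ := hcyc P x hx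
    refine ⟨P.homologyπ (n + 1) x', ?_⟩
    have : HomologicalComplex.cyclesMap f (n + 1) x' = c + X.toCycles n (n + 1) z :=
      hi X (by rw [hci, hz, map_add, hti])
    rw [hnat, this, map_add, hto, add_zero]

theorem exists_lift {A : Type u} [CommRing A] {M N K : Type u} [AddCommGroup M] [AddCommGroup N] [AddCommGroup K]
    [Module A M] [Module A N] [Module A K] [Module.Projective A M]
    (g : M →ₗ[A] N) (d : K →ₗ[A] N) (h : ∀ x, ∃ y, d y = g x) :
    ∃ s : M →ₗ[A] K, ∀ x, d (s x) = g x := by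
  obtain ⟨s, hs⟩ := Module.projective_lifting_property d.rangeRestrict
    (g.codRestrict (LinearMap.range d) h) d.surjective_rangeRestrict
  exact ⟨s, fun x => congrArg Subtype.val (LinearMap.congr_fun hs x)⟩

/-- Over a principal ideal domain every complex has a K-projective resolution. -/
theorem exists_kProjective_resolution {A : Type u} [CommRing A] [IsDomain A] [IsPrincipalIdealRing A]
    (X : CochainComplex (ModuleCat.{u} A) ℤ) :
    ∃ (P : CochainComplex (ModuleCat.{u} A) ℤ) (f : P ⟶ X), P.IsKProjective ∧ QuasiIso f := by
  let F (n : ℤ) : Type u := LinearMap.ker (X.d n (n + 1)).hom →₀ A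
  let a (n : ℤ) : F n →ₗ[A] X.X n := Finsupp.linearCombination A Subtype.val
  have ha (n : ℤ) (x : F n) : X.d n (n + 1) (a n x) = 0 := by
    have h1 : (X.d n (n + 1)).hom ∘ₗ a n = 0 := by
      ext z
      simp [a]
    exact LinearMap.congr_fun h1 x
  have ha' (n : ℤ) (y : X.X n) (hy : X.d n (n + 1) y = 0) : ∃ x : F n, a n x = y :=
    ⟨Finsupp.single ⟨y, hy⟩ 1, (Finsupp.linearCombination_single A _ _).trans (one_smul A y)⟩
  let R (n : ℤ) : Submodule A (F (n + 1)) :=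
    (LinearMap.range (X.d n (n + 1)).hom).comap (a (n + 1))
  have hR (n : ℤ) : Module.Projective A (R n) := projective_submodule _
  choose h hh using fun n : ℤ =>
    exists_lift (M := R n) (a (n + 1) ∘ₗ (R n).subtype) (X.d n (n + 1)).hom (by intro x; exact x.2)
  let d (n : ℤ) : (F n × R n) →ₗ[A] (F (n + 1) × R (n + 1)) :=
    LinearMap.inl A _ _ ∘ₗ (R n).subtype ∘ₗ LinearMap.snd A _ _
  let P : CochainComplex (ModuleCat.{u} A) ℤ :=
    CochainComplex.of (fun n => ModuleCat.of A (F n × R n)) (fun n => ModuleCat.ofHom (d n))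
      (fun n => ModuleCat.hom_ext (LinearMap.ext fun x => rfl))
  have hPd (n : ℤ) : P.d n (n + 1) = ModuleCat.ofHom (d n) :=
    CochainComplex.of_d (fun n => ModuleCat.of A (F n × R n)) (fun n => ModuleCat.ofHom (d n)) n
  let f : P ⟶ X :=
    { f := fun n => ModuleCat.ofHom (LinearMap.coprod (a n) (h n))
      comm' := by
        rintro i j (rfl : i + 1 = j)
        rw [hPd]
        refine ModuleCat.hom_ext (LinearMap.ext fun x => ?_)
        change X.d i (i + 1) (a i x.1 + h i x.2) = a (i + 1) x.2 + h (i + 1) 0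
        rw [map_add, ha, map_zero, zero_add, add_zero]
        exact hh i x.2 }
  refine ⟨P, f, ⟨fun {L} g hL => ?_⟩, quasiIso_of_elements f ?_ ?_⟩
  · have hL' (p q : ℤ) (hpq : q + 1 = p) (z : L.X p) (hz : L.d p (p + 1) z = 0) :
        ∃ y, L.d q p y = z := by
      have h1 := (L.exactAt_iff' q p (p + 1) (by simp; omega) (by simp)).1 (hL p)
      rw [ShortComplex.moduleCat_exact_iff] at h1
      exact h1 z hz
    have hg (n : ℤ) (x : F n × R n) : L.d n (n + 1) (g.f n x) = g.f (n + 1) (d n x) := by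
      have := ConcreteCategory.congr_hom (g.comm n (n + 1)) x
      rw [hPd] at this
      exact this
    choose s hs using fun (p q : ℤ) (hpq : q + 1 = p) =>
      exists_lift ((g.f p).hom ∘ₗ LinearMap.inl A (F p) (R p)) (L.d q p).hom (fun x =>
        hL' p q hpq _ (by
          refine (hg p (x, 0)).trans ?_
          have : d p (x, 0) = 0 := by simp [d]
          rw [this, map_zero]))
    choose t ht using fun (p q : ℤ) (hpq : q + 1 = p) =>
      exists_lift (M := R p) ((g.f p).hom ∘ₗ LinearMap.inr A (F p) (R p) - s (p + 1) p rfl ∘ₗ (R p).subtype)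
        (L.d q p).hom (fun x => hL' p q hpq (g.f p (0, x) - s (p + 1) p rfl x) (by
          rw [map_sub, sub_eq_zero, hg]
          exact (hs (p + 1) p rfl x).symm))
    refine ⟨{ hom := fun i j => if hij : j + 1 = i then
                ModuleCat.ofHom (LinearMap.coprod (s i j hij) (t i j hij)) else 0
              zero := fun i j hij => dif_neg hij
              comm := fun i => ?_ }⟩
    obtain ⟨j, rfl⟩ : ∃ j, i = j + 1 := ⟨i - 1, by ring⟩
    rw [dNext_eq _ (show (ComplexShape.up ℤ).Rel (j + 1) (j + 1 + 1) by simp),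
      prevD_eq _ (show (ComplexShape.up ℤ).Rel j (j + 1) by simp), hPd]
    simp only [dif_pos, HomologicalComplex.zero_f, add_zero]
    refine ModuleCat.hom_ext (LinearMap.ext fun (x : F (j + 1) × R (j + 1)) => ?_)
    change g.f (j + 1) x = (s (j + 1 + 1) (j + 1) rfl x.2 + t (j + 1 + 1) (j + 1) rfl 0) +
      L.d j (j + 1) (s (j + 1) j rfl x.1 + t (j + 1) j rfl x.2)
    have e1 : L.d j (j + 1) (s (j + 1) j rfl x.1) = g.f (j + 1) (x.1, 0) := hs (j + 1) j rfl x.1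
    have e2 : L.d j (j + 1) (t (j + 1) j rfl x.2) =
      g.f (j + 1) (0, x.2) - s (j + 1 + 1) (j + 1) rfl x.2 := ht (j + 1) j rfl x.2
    have e3 : g.f (j + 1) x = g.f (j + 1) (x.1, 0) + g.f (j + 1) (0, x.2) := by
      refine Eq.trans ?_ (map_add (g.f (j + 1)).hom _ _)
      exact congrArg (g.f (j + 1)).hom (Prod.ext (add_zero x.1).symm (zero_add x.2).symm)
    rw [map_add, e1, e2, e3, map_zero]
    abel
  · intro n x hx y hy
    rw [hPd] at hx
    obtain ⟨x1, x2⟩ : F (n + 1) × R (n + 1) := x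
    have hx2 : x2 = 0 := by
      have := congrArg Prod.fst (show ((x2 : F (n + 1 + 1)), (0 : R (n + 1 + 1))) = 0 from hx)
      exact Subtype.ext this
    subst hx2
    have hy' : X.d n (n + 1) y = a (n + 1) x1 := by
      refine hy.trans ?_
      change a (n + 1) x1 + h (n + 1) 0 = _
      rw [map_zero, add_zero]
    refine ⟨((0, ⟨x1, y, hy'⟩) : F n × R n), ?_⟩
    rw [hPd]
    rfl
  · intro n y hy
    obtain ⟨x, hx⟩ := ha' (n + 1) y hy
    refine ⟨((x, 0) : F (n + 1) × R (n + 1)), ?_, 0, ?_⟩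
    · rw [hPd]
      change ((((0 : R (n + 1)) : F (n + 1 + 1)), (0 : R (n + 1 + 1))) : F _ × R _) = 0
      rfl
    · change a (n + 1) x + h (n + 1) 0 = _
      rw [map_zero, map_zero, hx]

end Resolution

section Derived

variable {C : Type*} [Category* C] [Abelian C] [HasDerivedCategory.{w} C]
  {D : Type*} [Category* D] [Abelian D] [HasDerivedCategory.{w'} D]

theorem map_eq_of_Q_map_eq (T : C ⥤ D) [T.Additive] {P Y : CochainComplex C ℤ}
    [P.IsKProjective] (f g : P ⟶ Y)
    (h : (DerivedCategory.Q (C := C)).map f = DerivedCategory.Q.map g) :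
    (T.mapHomologicalComplex (ComplexShape.up ℤ) ⋙ DerivedCategory.Q).map f =
      (T.mapHomologicalComplex (ComplexShape.up ℤ) ⋙ DerivedCategory.Q).map g := by
  have h1 : (HomotopyCategory.quotient C (ComplexShape.up ℤ)).map f =
      (HomotopyCategory.quotient C (ComplexShape.up ℤ)).map g :=
    (CochainComplex.IsKProjective.Qh_map_bijective _ _).injective h
  have h2 := T.mapHomotopy (HomotopyCategory.homotopyOfEq _ _ h1)
  have h3 := HomotopyCategory.eq_of_homotopy _ _ h2
  exact congrArg DerivedCategory.Qh.map h3

theorem exists_Q_map_eq {P Y : CochainComplex C ℤ}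
    [P.IsKProjective] (φ : (DerivedCategory.Q (C := C)).obj P ⟶ DerivedCategory.Q.obj Y) :
    ∃ f : P ⟶ Y, DerivedCategory.Q.map f = φ := by
  obtain ⟨f, hf⟩ := (CochainComplex.IsKProjective.Qh_map_bijective P
    ((HomotopyCategory.quotient C (ComplexShape.up ℤ)).obj Y)).surjective φ
  obtain ⟨f, rfl⟩ := (HomotopyCategory.quotient _ _).map_surjective f
  exact ⟨f, hf⟩

theorem hasPointwiseLeftDerivedFunctorAt_of_isKProjective (T : C ⥤ D) [T.Additive]
    (P : CochainComplex C ℤ) [P.IsKProjective] :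
    (T.mapHomologicalComplex (ComplexShape.up ℤ) ⋙
      DerivedCategory.Q).HasPointwiseLeftDerivedFunctorAt
        (HomologicalComplex.quasiIso C (ComplexShape.up ℤ)) P := by
  rw [Functor.hasPointwiseLeftDerivedFunctorAt_iff _ DerivedCategory.Q]
  choose l hl using fun (j : StructuredArrow ((DerivedCategory.Q (C := C)).obj P)
    (DerivedCategory.Q (C := C))) => exists_Q_map_eq j.hom
  refine ⟨⟨⟨⟨(T.mapHomologicalComplex (ComplexShape.up ℤ) ⋙ DerivedCategory.Q).obj P,
    { app := fun j => (T.mapHomologicalComplex (ComplexShape.up ℤ) ⋙ DerivedCategory.Q).map (l j)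
      naturality := fun i j φ => ?_ }⟩,
    { lift := fun s => s.π.app (StructuredArrow.mk (𝟙 _))
      fac := fun s j => ?_
      uniq := fun s m hm => ?_ }⟩⟩⟩
  · have := map_eq_of_Q_map_eq T (l j) (l i ≫ φ.right) (by
      rw [Functor.map_comp, hl, hl]; exact (StructuredArrow.w φ).symm)
    rw [Functor.map_comp] at this
    exact (Category.id_comp _).trans this
  · exact (s.w (StructuredArrow.homMk (l j) (by simp [hl]) :
      StructuredArrow.mk (𝟙 _) ⟶ j))
  · have h1 := hm (StructuredArrow.mk (𝟙 _))
    have h2 := map_eq_of_Q_map_eq T (l (StructuredArrow.mk (𝟙 _))) (𝟙 P) (by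
      rw [hl, CategoryTheory.Functor.map_id]; rfl)
    rw [CategoryTheory.Functor.map_id] at h2
    rw [← h1]
    exact ((congrArg (m ≫ ·) h2).trans (Category.comp_id m)).symm

/-- Over a principal ideal domain every additive functor has a total left derived functor on the
unbounded derived category. -/
instance hasPointwiseLeftDerivedFunctor {A : Type u} [CommRing A] [IsDomain A]
    [IsPrincipalIdealRing A] [HasDerivedCategory.{w} (ModuleCat.{u} A)]
    (T : ModuleCat.{u} A ⥤ D) [T.Additive] :
    (T.mapHomologicalComplex (ComplexShape.up ℤ) ⋙
      DerivedCategory.Q).HasPointwiseLeftDerivedFunctor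
        (HomologicalComplex.quasiIso (ModuleCat.{u} A) (ComplexShape.up ℤ)) := by
  intro X
  obtain ⟨P, f, _, hf⟩ := exists_kProjective_resolution X
  rw [← Functor.hasPointwiseLeftDerivedFunctorAt_iff_of_mem _ _ f hf]
  exact hasPointwiseLeftDerivedFunctorAt_of_isKProjective T P

end Derived

section BaseChange

variable (A B : Type u) [CommRing A] [IsDomain A] [IsPrincipalIdealRing A] [CommRing B]
  [Algebra A B] [HasDerivedCategory.{w} (ModuleCat.{u} A)]
  [HasDerivedCategory.{w'} (ModuleCat.{u} B)]

instance extendScalars_additive :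
    (ModuleCat.extendScalars.{u, u, u} (algebraMap A B)).Additive :=
  (ModuleCat.extendRestrictScalarsAdj.{u, u, u} (algebraMap A B)).left_adjoint_additive

/-- The functor `- ⊗ᴸ_A B : D(A) ⥤ D(B)`, i.e. the total left derived functor of
extension of scalars along `A → B`. -/
noncomputable def derivedBaseChange :
    DerivedCategory (ModuleCat.{u} A) ⥤ DerivedCategory (ModuleCat.{u} B) :=
  ((ModuleCat.extendScalars.{u, u, u} (algebraMap A B)).mapHomologicalComplex
    (ComplexShape.up ℤ) ⋙ DerivedCategory.Q).totalLeftDerived DerivedCategory.Q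
      (HomologicalComplex.quasiIso (ModuleCat.{u} A) (ComplexShape.up ℤ))

end BaseChange

section Complexes

variable {R : Type u} [CommRing R] [HasDerivedCategory.{w} (ModuleCat.{u} R)]

/-- The cohomology module `Hⁱ(X)` of an object `X` of `D(R)`. -/
noncomputable abbrev cohomology (X : DerivedCategory (ModuleCat.{u} R)) (i : ℤ) : Type u :=
  (DerivedCategory.homologyFunctor (ModuleCat.{u} R) i).obj X

/-- An object of `D(R)` has finite tor-dimension if it is represented by a bounded complex of flat
`R`-modules. -/
def HasFiniteTorDimension (X : DerivedCategory (ModuleCat.{u} R)) : Prop :=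
  ∃ (F : CochainComplex (ModuleCat.{u} R) ℤ) (a b : ℤ),
    (∀ i, Module.Flat R (F.X i)) ∧ (∀ i, i < a ∨ b < i → Limits.IsZero (F.X i)) ∧
      Nonempty (DerivedCategory.Q.obj F ≅ X)

/-- The representation of `G` on `Hⁱ(X)` induced by an action of `G` on `X` in `D(R)`. -/
noncomputable def cohomologyRep {G : Type v} [Group G] {X : DerivedCategory (ModuleCat.{u} R)}
    (ρ : G →* End X) (i : ℤ) : Representation R G (cohomology X i) :=
  (ModuleCat.endRingEquiv _).toMonoidHom.comp
    (((DerivedCategory.homologyFunctor (ModuleCat.{u} R) i).mapEnd X).comp ρ)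

/-- The action of `G` on `X ⊗ᴸ_R B` induced by an action of `G` on `X` in `D(R)`. -/
noncomputable def derivedBaseChangeAction [IsDomain R] [IsPrincipalIdealRing R] (B : Type u)
    [CommRing B] [Algebra R B] [HasDerivedCategory.{w'} (ModuleCat.{u} B)]
    {G : Type v} [Group G] {X : DerivedCategory (ModuleCat.{u} R)} (ρ : G →* End X) :
    G →* End ((derivedBaseChange R B).obj X) :=
  ((derivedBaseChange R B).mapEnd X).comp ρ

end Complexes

section VirtualModules

/-- The representation of `G` on `B ⊗ M` obtained from a representation on the `R`-module `M`. -/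
noncomputable def baseChangeRep {R : Type*} (B : Type*) [CommRing R] [CommRing B] [Algebra R B]
    {G : Type*} [Group G] {M : Type*} [AddCommGroup M] [Module R M] (ρ : Representation R G M) :
    Representation B G (B ⊗[R] M) :=
  (Module.End.baseChangeHom R B M).toMonoidHom.comp ρ

/-- The elements `[V₂] - [V₁] - [V₃]` attached to the short exact sequences
`0 → V₁ → V₂ → V₃ → 0` of finite-dimensional `F[G]`-modules. -/
def exactRelations (F : Type u) [Field F] (G : Type v) [Group G] :
    Set (FreeAbelianGroup (FDRep F G)) :=
  {x | ∃ (V₁ V₂ V₃ : FDRep F G) (f : V₁ →ₗ[F] V₂) (g : V₂ →ₗ[F] V₃),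
    (∀ s v, f (V₁.ρ s v) = V₂.ρ s (f v)) ∧ (∀ s v, g (V₂.ρ s v) = V₃.ρ s (g v)) ∧
      Function.Injective f ∧ Function.Exact f g ∧ Function.Surjective g ∧
        x = FreeAbelianGroup.of V₂ - FreeAbelianGroup.of V₁ - FreeAbelianGroup.of V₃}

/-- The group of virtual `F[G]`-modules: the Grothendieck group of the category of
finite-dimensional `F[G]`-modules with respect to short exact sequences. -/
abbrev VirtualModule (F : Type u) [Field F] (G : Type v) [Group G] : Type (max (u + 1) v) :=
  FreeAbelianGroup (FDRep F G) ⧸ AddSubgroup.closure (exactRelations F G)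

/-- The class in the Grothendieck group of a finite-dimensional representation. -/
noncomputable def virtualClass {F : Type u} [Field F] {G : Type v} [Group G] {V : Type u} [AddCommGroup V]
    [Module F V] [Module.Finite F V] (ρ : Representation F G V) : VirtualModule F G :=
  QuotientAddGroup.mk (FreeAbelianGroup.of (FDRep.of ρ))

variable (A : Type u) [CommRing A] [IsLocalRing A] (K : Type u) [Field K] [Algebra A K]

/-- `IsReduction A K x y` says that the virtual `k[G]`-module `y` (`k` the residue field of `A`) is
a reduction of the virtual `K[G]`-module `x`: the pair `(x, y)` is a `ℤ`-linear combination of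
pairs `([K ⊗ Λ], [k ⊗ Λ])`, where `Λ` is a finite free `A`-module on which `G` acts `A`-linearly
(that is, a `G`-stable lattice in `K ⊗ Λ`). -/
def IsReduction {G : Type v} [Group G] (x : VirtualModule K G)
    (y : VirtualModule (ResidueField A) G) : Prop :=
  (x, y) ∈ AddSubgroup.closure
    {z : VirtualModule K G × VirtualModule (ResidueField A) G |
      ∃ (Λ : Type u) (_ : AddCommGroup Λ) (_ : Module A Λ) (_ : Module.Free A Λ)
        (_ : Module.Finite A Λ) (ρ : Representation A G Λ),
        z = (virtualClass (baseChangeRep K ρ),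
          virtualClass (baseChangeRep (ResidueField A) ρ))}

end VirtualModules

section BrauerCharacter

variable {A : Type u} [CommRing A] [IsLocalRing A] {K : Type u} [Field K] [Algebra A K]

/-- The ring of elements of an algebraic closure of `K` that are integral over `A` has a reduction
map, compatible with `A → k`, to an algebraic closure of the residue field `k` of `A`. -/
theorem nonempty_residueMap [IsDomain A] [IsFractionRing A K] :
    Nonempty (integralClosure A (AlgebraicClosure K) →ₐ[A]
      AlgebraicClosure (ResidueField A)) := by
  let O := integralClosure A (AlgebraicClosure K)
  have hinj : Function.Injective (algebraMap A (AlgebraicClosure K)) := by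
    rw [IsScalarTower.algebraMap_eq A K (AlgebraicClosure K)]
    exact (algebraMap K _).injective.comp (IsFractionRing.injective A K)
  have hinj' : Function.Injective (algebraMap A O) := fun x y h =>
    hinj (congrArg (algebraMap O (AlgebraicClosure K)) h)
  obtain ⟨M, hM, hMA⟩ := Ideal.exists_ideal_over_maximal_of_isIntegral (S := O)
    (maximalIdeal A) (by
      rw [(RingHom.injective_iff_ker_eq_bot _).1 hinj']; exact bot_le)
  let f : ResidueField A →+* O ⧸ M :=
    Ideal.quotientMap M (algebraMap A O) hMA.ge
  let _ : Field (O ⧸ M) := Ideal.Quotient.field M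
  let _ : Algebra (ResidueField A) (O ⧸ M) := f.toAlgebra
  have : IsScalarTower A (ResidueField A) (O ⧸ M) :=
    IsScalarTower.of_algebraMap_eq' rfl
  have : Algebra.IsIntegral A (O ⧸ M) := inferInstance
  have : Algebra.IsIntegral (ResidueField A) (O ⧸ M) :=
    Algebra.IsIntegral.tower_top A
  have : Algebra.IsAlgebraic (ResidueField A) (O ⧸ M) := inferInstance
  exact ⟨((IsAlgClosed.lift : (O ⧸ M) →ₐ[ResidueField A]
    AlgebraicClosure (ResidueField A)).restrictScalars A).comp
      (Ideal.Quotient.mkₐ A M)⟩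

open scoped Classical in
/-- The Teichmüller lift of a root of unity `ε` of order prime to `p` in an algebraic closure of the
residue field of `A`: the root of unity of order prime to `p` which reduces to `ε` (and `0` for
other `ε`). -/
noncomputable def teichmullerLift (p : ℕ)
    (res : integralClosure A (AlgebraicClosure K) →ₐ[A]
      AlgebraicClosure (ResidueField A))
    (ε : AlgebraicClosure (ResidueField A)) : AlgebraicClosure K :=
  if h : ∃ z : integralClosure A (AlgebraicClosure K), (∃ n : ℕ, ¬ p ∣ n ∧ z ^ n = 1) ∧ res z = ε
  then (h.choose : AlgebraicClosure K) else 0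

/-- The Brauer character of a finite-dimensional `k[G]`-module: the sum of the Teichmüller lifts of
the eigenvalues, with multiplicity, of `g`. It is meaningful for `p`-regular `g`. -/
noncomputable def brauerCharacter (p : ℕ)
    (res : integralClosure A (AlgebraicClosure K) →ₐ[A]
      AlgebraicClosure (ResidueField A))
    {G : Type v} [Group G] {V : Type u} [AddCommGroup V]
    [Module (ResidueField A) V] [Module.Finite (ResidueField A) V]
    (ρ : Representation (ResidueField A) G V) (g : G) : AlgebraicClosure K :=
  (((ρ g).charpoly.aroots (AlgebraicClosure (ResidueField A))).map
    (teichmullerLift p res)).sum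

end BrauerCharacter

end PerfectReduction

open PerfectReduction

/-! Let `ϖ` be a uniformizer of `A`. Represent `L` by a K-projective complex `P` with projective
terms, so that `L ⊗ᴸ k` is `P ⊗ k` and multiplication by `ϖ` gives a short exact sequence `0 → P → P
→ P ⊗ k → 0` of complexes. Its long exact sequence breaks up into universal coefficient sequences `0
→ k ⊗ Hⁱ(L) → Hⁱ(L ⊗ᴸ k) → Hⁱ⁺¹(L)[ϖ] → 0`. The action of `G` need not lift to `P`, but each
endomorphism of `L` in `D(A)` lifts to a chain map, and naturality for one endomorphism at a time
already makes these sequences `G`-equivariant (`exists_universalCoefficient_sequence`).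

For a finitely generated `A`-module `M` with `G`-action put `r(M) = [k ⊗ M] - [M[ϖ]]`
(`reductionClass`). Taking alternating sums and shifting the torsion terms by one degree gives `∑
(-1)ⁱ [Hⁱ(L ⊗ᴸ k)] = ∑ (-1)ⁱ r(Hⁱ(L))` (`finsum_virtualClass_derivedBaseChange`). By the snake lemma
`r` is additive in exact sequences (`reductionClass_eq_add`). It vanishes on modules killed by `ϖ`,
hence on all torsion modules, so `r(M)` depends only on `K ⊗ M`. Since `G` is finite, every
representation over `K` contains a stable lattice, and `r` therefore induces a homomorphism `d` from
virtual `K[G]`-modules to virtual `k[G]`-modules (`exists_decomposition`). A lattice has no torsion,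
so the graph of `d` is exactly the relation `IsReduction` (`isReduction_iff`). This gives existence
and uniqueness of the reduction.

For the character identity, character and Brauer character at `g` are both additive in exact
sequences, so it suffices to treat a lattice. There the characteristic polynomial of `g` has
coefficients in `A`; its roots are integral, are roots of unity of order prime to `p`, and reduce to
the eigenvalues modulo the maximal ideal (`character_eq_brauerCharacter`). -/

namespace PerfectReduction

/-! ### Projective resolutions of unbounded complexes over a principal ideal domain -/

section Resolution

/-- Over a principal ideal domain every complex has a K-projective resolution with projective
terms. -/
theorem exists_kProjective_projective_resolution {A : Type u} [CommRing A] [IsDomain A] [IsPrincipalIdealRing A]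
    (X : CochainComplex (ModuleCat.{u} A) ℤ) :
    ∃ (P : CochainComplex (ModuleCat.{u} A) ℤ) (f : P ⟶ X), P.IsKProjective ∧
      (∀ n, Module.Projective A (P.X n)) ∧ QuasiIso f := by
  let F (n : ℤ) : Type u := LinearMap.ker (X.d n (n + 1)).hom →₀ A
  let a (n : ℤ) : F n →ₗ[A] X.X n := Finsupp.linearCombination A Subtype.val
  have ha (n : ℤ) (x : F n) : X.d n (n + 1) (a n x) = 0 := by
    have h1 : (X.d n (n + 1)).hom ∘ₗ a n = 0 := by
      ext z
      simp [a]
    exact LinearMap.congr_fun h1 x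
  have ha' (n : ℤ) (y : X.X n) (hy : X.d n (n + 1) y = 0) : ∃ x : F n, a n x = y :=
    ⟨Finsupp.single ⟨y, hy⟩ 1, (Finsupp.linearCombination_single A _ _).trans (one_smul A y)⟩
  -- `F (n + 1)` covers the cycles and `R n` is the preimage of the boundaries, so `R n → F (n + 1)`
  -- is a two-term projective resolution of `Hⁿ⁺¹(X)`. The complex `P` is the direct sum of all of
  -- these, and `h` picks a primitive in `X` of each boundary coming from `R n`.
  let R (n : ℤ) : Submodule A (F (n + 1)) :=
    (LinearMap.range (X.d n (n + 1)).hom).comap (a (n + 1))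
  have hR (n : ℤ) : Module.Projective A (R n) := projective_submodule _
  choose h hh using fun n : ℤ =>
    exists_lift (M := R n) (a (n + 1) ∘ₗ (R n).subtype) (X.d n (n + 1)).hom (by intro x; exact x.2)
  let d (n : ℤ) : (F n × R n) →ₗ[A] (F (n + 1) × R (n + 1)) :=
    LinearMap.inl A _ _ ∘ₗ (R n).subtype ∘ₗ LinearMap.snd A _ _
  let P : CochainComplex (ModuleCat.{u} A) ℤ :=
    CochainComplex.of (fun n => ModuleCat.of A (F n × R n)) (fun n => ModuleCat.ofHom (d n))
      (fun n => ModuleCat.hom_ext (LinearMap.ext fun x => rfl))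
  have hPd (n : ℤ) : P.d n (n + 1) = ModuleCat.ofHom (d n) :=
    CochainComplex.of_d (fun n => ModuleCat.of A (F n × R n)) (fun n => ModuleCat.ofHom (d n)) n
  let f : P ⟶ X :=
    { f := fun n => ModuleCat.ofHom (LinearMap.coprod (a n) (h n))
      comm' := by
        rintro i j (rfl : i + 1 = j)
        rw [hPd]
        refine ModuleCat.hom_ext (LinearMap.ext fun x => ?_)
        change X.d i (i + 1) (a i x.1 + h i x.2) = a (i + 1) x.2 + h (i + 1) 0
        rw [map_add, ha, map_zero, zero_add, add_zero]
        exact hh i x.2 }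
  refine ⟨P, f, ⟨fun {L} g hL => ?_⟩,
    fun n => inferInstanceAs (Module.Projective A (F n × R n)), quasiIso_of_elements f ?_ ?_⟩
  · have hL' (p q : ℤ) (hpq : q + 1 = p) (z : L.X p) (hz : L.d p (p + 1) z = 0) :
        ∃ y, L.d q p y = z := by
      have h1 := (L.exactAt_iff' q p (p + 1) (by simp; omega) (by simp)).1 (hL p)
      rw [ShortComplex.moduleCat_exact_iff] at h1
      exact h1 z hz
    have hg (n : ℤ) (x : F n × R n) : L.d n (n + 1) (g.f n x) = g.f (n + 1) (d n x) := by
      have := ConcreteCategory.congr_hom (g.comm n (n + 1)) x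
      rw [hPd] at this
      exact this
    -- Null-homotopy of a map `g` to an acyclic complex. On `F p` the differential vanishes, so `g`
    -- has values in cycles, and projectivity lifts it through the differential of `L`. On `R p` the
    -- same works after subtracting the contribution of `s` from the next degree.
    choose s hs using fun (p q : ℤ) (hpq : q + 1 = p) =>
      exists_lift ((g.f p).hom ∘ₗ LinearMap.inl A (F p) (R p)) (L.d q p).hom (fun x =>
        hL' p q hpq _ (by
          refine (hg p (x, 0)).trans ?_
          have : d p (x, 0) = 0 := by simp [d]
          rw [this, map_zero]))
    choose t ht using fun (p q : ℤ) (hpq : q + 1 = p) =>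
      exists_lift (M := R p) ((g.f p).hom ∘ₗ LinearMap.inr A (F p) (R p) - s (p + 1) p rfl ∘ₗ (R p).subtype)
        (L.d q p).hom (fun x => hL' p q hpq (g.f p (0, x) - s (p + 1) p rfl x) (by
          rw [map_sub, sub_eq_zero, hg]
          exact (hs (p + 1) p rfl x).symm))
    refine ⟨{ hom := fun i j => if hij : j + 1 = i then
                ModuleCat.ofHom (LinearMap.coprod (s i j hij) (t i j hij)) else 0
              zero := fun i j hij => dif_neg hij
              comm := fun i => ?_ }⟩
    obtain ⟨j, rfl⟩ : ∃ j, i = j + 1 := ⟨i - 1, by ring⟩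
    rw [dNext_eq _ (show (ComplexShape.up ℤ).Rel (j + 1) (j + 1 + 1) by simp),
      prevD_eq _ (show (ComplexShape.up ℤ).Rel j (j + 1) by simp), hPd]
    simp only [dif_pos, HomologicalComplex.zero_f, add_zero]
    refine ModuleCat.hom_ext (LinearMap.ext fun (x : F (j + 1) × R (j + 1)) => ?_)
    change g.f (j + 1) x = (s (j + 1 + 1) (j + 1) rfl x.2 + t (j + 1 + 1) (j + 1) rfl 0) +
      L.d j (j + 1) (s (j + 1) j rfl x.1 + t (j + 1) j rfl x.2)
    have e1 : L.d j (j + 1) (s (j + 1) j rfl x.1) = g.f (j + 1) (x.1, 0) := hs (j + 1) j rfl x.1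
    have e2 : L.d j (j + 1) (t (j + 1) j rfl x.2) =
      g.f (j + 1) (0, x.2) - s (j + 1 + 1) (j + 1) rfl x.2 := ht (j + 1) j rfl x.2
    have e3 : g.f (j + 1) x = g.f (j + 1) (x.1, 0) + g.f (j + 1) (0, x.2) := by
      refine Eq.trans ?_ (map_add (g.f (j + 1)).hom _ _)
      exact congrArg (g.f (j + 1)).hom (Prod.ext (add_zero x.1).symm (zero_add x.2).symm)
    rw [map_add, e1, e2, e3, map_zero]
    abel
  · intro n x hx y hy
    rw [hPd] at hx
    obtain ⟨x1, x2⟩ : F (n + 1) × R (n + 1) := x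
    have hx2 : x2 = 0 := by
      have := congrArg Prod.fst (show ((x2 : F (n + 1 + 1)), (0 : R (n + 1 + 1))) = 0 from hx)
      exact Subtype.ext this
    subst hx2
    have hy' : X.d n (n + 1) y = a (n + 1) x1 := by
      refine hy.trans ?_
      change a (n + 1) x1 + h (n + 1) 0 = _
      rw [map_zero, add_zero]
    refine ⟨((0, ⟨x1, y, hy'⟩) : F n × R n), ?_⟩
    rw [hPd]
    rfl
  · intro n y hy
    obtain ⟨x, hx⟩ := ha' (n + 1) y hy
    refine ⟨((x, 0) : F (n + 1) × R (n + 1)), ?_, 0, ?_⟩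
    · rw [hPd]
      change ((((0 : R (n + 1)) : F (n + 1 + 1)), (0 : R (n + 1 + 1))) : F _ × R _) = 0
      rfl
    · change a (n + 1) x + h (n + 1) 0 = _
      rw [map_zero, map_zero, hx]

end Resolution

/-! ### Derived functors evaluated on K-projective complexes -/

section Derived

variable {C : Type*} [Category* C] [Abelian C] [HasDerivedCategory.{w} C]
  {D : Type*} [Category* D] [Abelian D] [HasDerivedCategory.{w'} D]

/-- The total left derived functor of an additive functor is computed by K-projective complexes. -/
theorem isIso_totalLeftDerivedCounit_app (T : C ⥤ D) [T.Additive]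
    [(T.mapHomologicalComplex (ComplexShape.up ℤ) ⋙
      DerivedCategory.Q).HasPointwiseLeftDerivedFunctor
        (HomologicalComplex.quasiIso C (ComplexShape.up ℤ))]
    (P : CochainComplex C ℤ) [P.IsKProjective] :
    IsIso (((T.mapHomologicalComplex (ComplexShape.up ℤ) ⋙
      DerivedCategory.Q).totalLeftDerivedCounit DerivedCategory.Q
        (HomologicalComplex.quasiIso C (ComplexShape.up ℤ))).app P) := by
  let TQ := T.mapHomologicalComplex (ComplexShape.up ℤ) ⋙ DerivedCategory.Q (C := D)
  let W := HomologicalComplex.quasiIso C (ComplexShape.up ℤ)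
  let LT := TQ.totalLeftDerived DerivedCategory.Q W
  let α : DerivedCategory.Q ⋙ LT ⟶ TQ := TQ.totalLeftDerivedCounit DerivedCategory.Q W
  have hlim := Functor.isPointwiseRightKanExtensionOfHasPointwiseLeftDerivedFunctor LT α W
    (DerivedCategory.Q.obj P)
  -- The value of the derived functor at `Q P` is a limit over arrows `Q P ⟶ Q Y`. Each comes from a
  -- chain map `P ⟶ Y`, unique up to homotopy, so `TQ.obj P` carries a compatible cone; the induced
  -- map to the limit is the inverse of the counit.
  choose l hl using fun (j : StructuredArrow ((DerivedCategory.Q (C := C)).obj P)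
    (DerivedCategory.Q (C := C))) => exists_Q_map_eq j.hom
  let c : Limits.Cone (StructuredArrow.proj ((DerivedCategory.Q (C := C)).obj P)
      DerivedCategory.Q ⋙ TQ) :=
    { pt := TQ.obj P
      π := { app := fun j => TQ.map (l j)
             naturality := fun i j φ => by
              have := map_eq_of_Q_map_eq T (l j) (l i ≫ φ.right) (by
                rw [Functor.map_comp, hl, hl]; exact (StructuredArrow.w φ).symm)
              rw [Functor.map_comp] at this
              exact (Category.id_comp _).trans this } }
  let s : TQ.obj P ⟶ LT.obj (DerivedCategory.Q.obj P) := hlim.lift c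
  have hs (j : StructuredArrow ((DerivedCategory.Q (C := C)).obj P)
      (DerivedCategory.Q (C := C))) :
      s ≫ LT.map j.hom ≫ α.app j.right = TQ.map (l j) := hlim.fac c j
  refine ⟨s, hlim.hom_ext fun j => ?_, ?_⟩
  · change (α.app P ≫ s) ≫ LT.map j.hom ≫ α.app j.right =
      𝟙 _ ≫ LT.map j.hom ≫ α.app j.right
    rw [Category.assoc, hs, Category.id_comp, ← hl]
    exact (α.naturality (l j)).symm
  · have h1 := hs (StructuredArrow.mk (𝟙 _))
    have h2 := map_eq_of_Q_map_eq T (l (StructuredArrow.mk (𝟙 _))) (𝟙 P) (by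
      rw [hl, CategoryTheory.Functor.map_id]; rfl)
    rw [CategoryTheory.Functor.map_id] at h2
    refine Eq.trans ?_ (h1.trans h2)
    change s ≫ α.app P = s ≫ LT.map (𝟙 _) ≫ α.app P
    rw [CategoryTheory.Functor.map_id, Category.id_comp]

end Derived

/-! ### Tensoring with the residue field as reduction modulo a uniformizer -/

section ResidueTensor

variable {A : Type*} [CommRing A] [IsLocalRing A]

theorem one_tmul_surjective (M : Type*) [AddCommGroup M]
    [Module A M] : Function.Surjective fun x : M => (1 : ResidueField A) ⊗ₜ[A] x := by
  intro y
  induction y using TensorProduct.induction_on with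
  | zero => exact ⟨0, by simp⟩
  | tmul a x =>
    obtain ⟨a, rfl⟩ := IsLocalRing.residue_surjective a
    refine ⟨a • x, ?_⟩
    simp only [TensorProduct.tmul_smul, TensorProduct.smul_tmul', Algebra.smul_def, mul_one]
    rfl
  | add a b ha hb =>
    obtain ⟨x, rfl⟩ := ha
    obtain ⟨y, rfl⟩ := hb
    exact ⟨x + y, TensorProduct.tmul_add _ _ _⟩

theorem algebraMap_residue_uniformizer {ϖ : A} (hϖ : maximalIdeal A = Ideal.span {ϖ}) :
    algebraMap A (ResidueField A) ϖ = 0 := by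
  have : ϖ ∈ maximalIdeal A := hϖ ▸ Ideal.mem_span_singleton_self ϖ
  simpa using this

/-- The tensor product with the residue field is the quotient of `M` by the maximal ideal, which is
generated by `ϖ`. Together with `one_tmul_surjective` it lets exactness be checked on elements of
`M`. -/
theorem one_tmul_eq_zero_iff {ϖ : A}
    (hϖ : maximalIdeal A = Ideal.span {ϖ}) {M : Type*} [AddCommGroup M]
    [Module A M] (x : M) : (1 : ResidueField A) ⊗ₜ[A] x = 0 ↔ ∃ y, ϖ • y = x := by
  constructor
  · intro h
    have h1 : TensorProduct.quotTensorEquivQuotSMul M (maximalIdeal A)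
      ((1 : A ⧸ maximalIdeal A) ⊗ₜ[A] x) = 0 :=
      (congrArg (TensorProduct.quotTensorEquivQuotSMul M (maximalIdeal A)) h).trans (map_zero _)
    have h2 : TensorProduct.quotTensorEquivQuotSMul M (maximalIdeal A)
      ((1 : A ⧸ maximalIdeal A) ⊗ₜ[A] x) = Submodule.Quotient.mk x :=
      (TensorProduct.quotTensorEquivQuotSMul_mk_tmul _ 1 x).trans (by rw [one_smul])
    have h3 := h2.symm.trans h1
    rw [Submodule.Quotient.mk_eq_zero, hϖ, Submodule.ideal_span_singleton_smul,
      Submodule.mem_smul_pointwise_iff_exists] at h3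
    obtain ⟨y, -, hy⟩ := h3
    exact ⟨y, hy⟩
  · rintro ⟨y, rfl⟩
    rw [TensorProduct.tmul_smul, TensorProduct.smul_tmul', Algebra.smul_def,
      algebraMap_residue_uniformizer hϖ, zero_mul, TensorProduct.zero_tmul]

end ResidueTensor

/-! ### The long exact sequence of multiplication by a uniformizer on a flat complex -/

section UniversalCoefficients

open ModuleCat

variable {A : Type u} [CommRing A] [IsLocalRing A]

/-- The short complex `P ⟶ P ⟶ P ⊗ k` of complexes of `A`-modules, in which the first map is
multiplication by `ϖ`. -/
noncomputable def reductionSequence {ϖ : A} (hϖ : maximalIdeal A = Ideal.span {ϖ})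
    (P : CochainComplex (ModuleCat.{u} A) ℤ) :
    ShortComplex (CochainComplex (ModuleCat.{u} A) ℤ) where
  X₁ := P
  X₂ := P
  X₃ := ((restrictScalars.{u} (algebraMap A (ResidueField A))).mapHomologicalComplex _).obj
    (((extendScalars.{u, u, u} (algebraMap A (ResidueField A))).mapHomologicalComplex _).obj P)
  f := ϖ • 𝟙 P
  g :=
    { f := fun n => (extendRestrictScalarsAdj.{u, u, u}
        (algebraMap A (ResidueField A))).unit.app (P.X n)
      comm' := fun i j _ => ((extendRestrictScalarsAdj.{u, u, u}
        (algebraMap A (ResidueField A))).unit.naturality (P.d i j)).symm }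
  zero := by
    ext n x
    exact (one_tmul_eq_zero_iff hϖ _).2 ⟨x, rfl⟩

/-- Exactness is checked degree by degree; flatness turns the nonzerodivisor `ϖ` into an injective
multiplication on each term. -/
theorem reductionSequence_shortExact {ϖ : A} (hϖ : maximalIdeal A = Ideal.span {ϖ})
    (h0 : ϖ ∈ nonZeroDivisors A)
    (P : CochainComplex (ModuleCat.{u} A) ℤ) (hP : ∀ n, Module.Flat A (P.X n)) :
    (reductionSequence hϖ P).ShortExact := by
  refine HomologicalComplex.shortExact_of_degreewise_shortExact _ fun n => ?_
  refine ShortComplex.ShortExact.mk' ?_ ?_ ?_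
  · rw [ShortComplex.moduleCat_exact_iff]
    intro x hx
    exact (one_tmul_eq_zero_iff hϖ _).1 hx
  · rw [ModuleCat.mono_iff_injective]
    intro x y hxy
    have := hP n
    exact Module.Flat.isSMulRegular_of_nonZeroDivisors (M := P.X n) h0 hxy
  · rw [ModuleCat.epi_iff_surjective]
    exact one_tmul_surjective _

/-- The endomorphism of `reductionSequence` induced by a chain map. -/
noncomputable def reductionSequenceMap {ϖ : A} (hϖ : maximalIdeal A = Ideal.span {ϖ})
    {P : CochainComplex (ModuleCat.{u} A) ℤ} (f : P ⟶ P) :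
    reductionSequence hϖ P ⟶ reductionSequence hϖ P where
  τ₁ := f
  τ₂ := f
  τ₃ := ((restrictScalars.{u} (algebraMap A (ResidueField A))).mapHomologicalComplex _).map
    (((extendScalars.{u, u, u} (algebraMap A (ResidueField A))).mapHomologicalComplex _).map f)
  comm₁₂ := by
    simp [reductionSequence]
  comm₂₃ := by
    ext n : 1
    exact (extendRestrictScalarsAdj.{u, u, u}
        (algebraMap A (ResidueField A))).unit.naturality (f.f n)

/-- The long exact homology sequence of `reductionSequence`. Restriction of scalars is exact, so it
commutes with homology and the third term is the homology of the complex over the residue field.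
Naturality is recorded for every chain endomorphism because the group action will be available only
through such lifts. -/
theorem exists_homology_reduction_sequence {ϖ : A} (hϖ : maximalIdeal A = Ideal.span {ϖ})
    (h0 : ϖ ∈ nonZeroDivisors A)
    (P : CochainComplex (ModuleCat.{u} A) ℤ) (hP : ∀ n, Module.Flat A (P.X n)) (i : ℤ) :
    ∃ (a : P.homology i ⟶ (restrictScalars.{u} (algebraMap A (ResidueField A))).obj
        ((((extendScalars.{u, u, u} (algebraMap A (ResidueField A))).mapHomologicalComplex
          (ComplexShape.up ℤ)).obj P).homology i))
      (b : (restrictScalars.{u} (algebraMap A (ResidueField A))).obj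
        ((((extendScalars.{u, u, u} (algebraMap A (ResidueField A))).mapHomologicalComplex
          (ComplexShape.up ℤ)).obj P).homology i) ⟶ P.homology (i + 1)),
      (∀ x, a x = 0 ↔ ∃ y, ϖ • y = x) ∧ (∀ z, b z = 0 ↔ ∃ x, a x = z) ∧
      (∀ y, ϖ • y = 0 ↔ ∃ z, b z = y) ∧
      ∀ f : P ⟶ P,
        HomologicalComplex.homologyMap f i ≫ a =
          a ≫ (restrictScalars.{u} (algebraMap A (ResidueField A))).map
            (HomologicalComplex.homologyMap (((extendScalars.{u, u, u}
              (algebraMap A (ResidueField A))).mapHomologicalComplex _).map f) i) ∧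
        (restrictScalars.{u} (algebraMap A (ResidueField A))).map
            (HomologicalComplex.homologyMap (((extendScalars.{u, u, u}
              (algebraMap A (ResidueField A))).mapHomologicalComplex _).map f) i) ≫ b =
          b ≫ HomologicalComplex.homologyMap f (i + 1) := by
  let R := restrictScalars.{u} (algebraMap A (ResidueField A))
  let E := (extendScalars.{u, u, u} (algebraMap A (ResidueField A))).mapHomologicalComplex
    (ComplexShape.up ℤ)
  have hS := reductionSequence_shortExact hϖ h0 P hP
  have hrel : (ComplexShape.up ℤ).Rel i (i + 1) := rfl
  let e : (reductionSequence hϖ P).X₃.homology i ≅ R.obj ((E.obj P).homology i) :=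
    ((E.obj P).sc i).mapHomologyIso R
  have he (f : P ⟶ P) : HomologicalComplex.homologyMap (reductionSequenceMap hϖ f).τ₃ i ≫ e.hom =
      e.hom ≫ R.map (HomologicalComplex.homologyMap (E.map f) i) :=
    ShortComplex.mapHomologyIso_hom_naturality
      ((HomologicalComplex.shortComplexFunctor _ _ i).map (E.map f)) R
  have he' (f : P ⟶ P) : R.map (HomologicalComplex.homologyMap (E.map f) i) ≫ e.inv =
      e.inv ≫ HomologicalComplex.homologyMap (reductionSequenceMap hϖ f).τ₃ i := by
    rw [Iso.comp_inv_eq, Category.assoc, he, Iso.inv_hom_id_assoc]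
  have hmul (j : ℤ) (x : P.homology j) :
      HomologicalComplex.homologyMap (reductionSequence hϖ P).f j x = ϖ • x := by
    have h1 : HomologicalComplex.homologyMap (reductionSequence hϖ P).f j = ϖ • 𝟙 (P.homology j) :=
      (ShortComplex.homologyMap_smul (𝟙 (P.sc j)) ϖ).trans (by
        rw [ShortComplex.homologyMap_id]; rfl)
    exact ConcreteCategory.congr_hom h1 x
  have hinj : Function.Injective e.hom := (ModuleCat.mono_iff_injective _).1 inferInstance
  have hei (x) : e.hom (e.inv x) = x := ConcreteCategory.congr_hom e.inv_hom_id x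
  have hie (x) : e.inv (e.hom x) = x := ConcreteCategory.congr_hom e.hom_inv_id x
  refine ⟨HomologicalComplex.homologyMap (reductionSequence hϖ P).g i ≫ e.hom,
    e.inv ≫ hS.δ i (i + 1) hrel, fun x => ?_, fun z => ?_, fun y => ?_, fun f => ⟨?_, ?_⟩⟩
  · have h1 := (ShortComplex.ShortExact.moduleCat_exact_iff_function_exact _).1
      (hS.homology_exact₂ i)
    exact (map_eq_zero_iff e.hom.hom hinj).trans
      ((h1 x).trans (exists_congr fun y => Eq.congr_left (hmul i y)))
  · have h1 := (ShortComplex.ShortExact.moduleCat_exact_iff_function_exact _).1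
      (hS.homology_exact₃ i (i + 1) hrel)
    refine (h1 (e.inv z)).trans (exists_congr fun y => ?_)
    exact ⟨fun h => (congrArg e.hom h).trans (hei z), fun h => hinj (h.trans (hei z).symm)⟩
  · have h1 := (ShortComplex.ShortExact.moduleCat_exact_iff_function_exact _).1
      (hS.homology_exact₁ i (i + 1) hrel)
    rw [← hmul]
    refine (h1 y).trans ⟨fun ⟨z, hz⟩ => ⟨e.hom z, ?_⟩, fun ⟨z, hz⟩ => ⟨e.inv z, hz⟩⟩
    exact (congrArg (hS.δ i (i + 1) hrel) (hie z)).trans hz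
  · ext x
    have h1 : HomologicalComplex.homologyMap (reductionSequenceMap hϖ f).τ₂ i ≫
        HomologicalComplex.homologyMap (reductionSequence hϖ P).g i =
        HomologicalComplex.homologyMap (reductionSequence hϖ P).g i ≫
          HomologicalComplex.homologyMap (reductionSequenceMap hϖ f).τ₃ i := by
      rw [← HomologicalComplex.homologyMap_comp, ← HomologicalComplex.homologyMap_comp,
        (reductionSequenceMap hϖ f).comm₂₃]
    exact (congrArg e.hom (ConcreteCategory.congr_hom h1 x)).trans
      (ConcreteCategory.congr_hom (he f) _)
  · ext x
    exact (congrArg (hS.δ i (i + 1) hrel) (ConcreteCategory.congr_hom (he' f) x)).trans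
      (ConcreteCategory.congr_hom (HomologicalComplex.HomologySequence.δ_naturality
        (reductionSequenceMap hϖ f) hS hS i (i + 1) hrel) (e.inv x)).symm

end UniversalCoefficients

/-! ### Universal coefficients in the derived category -/

section UniversalCoefficients

open ModuleCat

variable {A : Type u} [CommRing A] [IsDomain A] [IsPrincipalIdealRing A] [IsLocalRing A]
  [HasDerivedCategory.{w} (ModuleCat.{u} A)]
  [HasDerivedCategory.{w'} (ModuleCat.{u} (ResidueField A))]

/-- Transport of the sequence for a K-projective resolution `P` along `Q P ≅ L`. The derived base
change of `L` is computed by `P ⊗ k` because its counit is an isomorphism at `P`. -/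
theorem exists_cohomology_reduction_sequence {ϖ : A} (hϖ : maximalIdeal A = Ideal.span {ϖ})
    (h0 : ϖ ∈ nonZeroDivisors A) (L : DerivedCategory (ModuleCat.{u} A)) (i : ℤ) :
    ∃ (a : (DerivedCategory.homologyFunctor (ModuleCat.{u} A) i).obj L ⟶
        (restrictScalars.{u} (algebraMap A (ResidueField A))).obj
          ((DerivedCategory.homologyFunctor (ModuleCat.{u} (ResidueField A)) i).obj
            ((derivedBaseChange A (ResidueField A)).obj L)))
      (b : (restrictScalars.{u} (algebraMap A (ResidueField A))).obj
          ((DerivedCategory.homologyFunctor (ModuleCat.{u} (ResidueField A)) i).obj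
            ((derivedBaseChange A (ResidueField A)).obj L)) ⟶
        (DerivedCategory.homologyFunctor (ModuleCat.{u} A) (i + 1)).obj L),
      (∀ x, a x = 0 ↔ ∃ y, ϖ • y = x) ∧ (∀ z, b z = 0 ↔ ∃ x, a x = z) ∧
      (∀ y, ϖ • y = 0 ↔ ∃ z, b z = y) ∧
      ∀ φ : L ⟶ L,
        (DerivedCategory.homologyFunctor (ModuleCat.{u} A) i).map φ ≫ a =
          a ≫ (restrictScalars.{u} (algebraMap A (ResidueField A))).map
            ((DerivedCategory.homologyFunctor (ModuleCat.{u} (ResidueField A)) i).map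
              ((derivedBaseChange A (ResidueField A)).map φ)) ∧
        (restrictScalars.{u} (algebraMap A (ResidueField A))).map
            ((DerivedCategory.homologyFunctor (ModuleCat.{u} (ResidueField A)) i).map
              ((derivedBaseChange A (ResidueField A)).map φ)) ≫ b =
          b ≫ (DerivedCategory.homologyFunctor (ModuleCat.{u} A) (i + 1)).map φ := by
  let H (j : ℤ) := DerivedCategory.homologyFunctor (ModuleCat.{u} A) j
  let Hk := DerivedCategory.homologyFunctor (ModuleCat.{u} (ResidueField A)) i
  let R := restrictScalars.{u} (algebraMap A (ResidueField A))
  let E := (extendScalars.{u, u, u} (algebraMap A (ResidueField A))).mapHomologicalComplex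
    (ComplexShape.up ℤ)
  let LT : DerivedCategory (ModuleCat.{u} A) ⥤ DerivedCategory (ModuleCat.{u} (ResidueField A)) :=
    derivedBaseChange A (ResidueField A)
  obtain ⟨P, q, _, hproj, _⟩ :=
    exists_kProjective_projective_resolution (DerivedCategory.Q.objPreimage L)
  let e : DerivedCategory.Q.obj P ≅ L :=
    asIso (DerivedCategory.Q.map q) ≪≫ DerivedCategory.Q.objObjPreimageIso L
  let α : DerivedCategory.Q ⋙ LT ⟶ E ⋙ DerivedCategory.Q :=
    (E ⋙ DerivedCategory.Q).totalLeftDerivedCounit DerivedCategory.Q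
      (HomologicalComplex.quasiIso (ModuleCat.{u} A) (ComplexShape.up ℤ))
  have hα : IsIso (α.app P) := isIso_totalLeftDerivedCounit_app _ P
  let eA (j : ℤ) : (H j).obj L ≅ P.homology j :=
    (H j).mapIso e.symm ≪≫ (DerivedCategory.homologyFunctorFactors (ModuleCat.{u} A) j).app P
  let β : LT.obj (DerivedCategory.Q.obj P) ≅ DerivedCategory.Q.obj (E.obj P) := asIso (α.app P)
  let γ : Hk.obj (DerivedCategory.Q.obj (E.obj P)) ≅ (E.obj P).homology i :=
    (DerivedCategory.homologyFunctorFactors (ModuleCat.{u} (ResidueField A)) i).app (E.obj P)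
  let ek : Hk.obj (LT.obj L) ≅ (E.obj P).homology i := Hk.mapIso (LT.mapIso e.symm ≪≫ β) ≪≫ γ
  -- K-projectivity realizes `φ` by a chain map. The lifts of different `φ` need not compose
  -- strictly; each is used only for its own naturality square.
  have hlift (φ : L ⟶ L) : ∃ f : P ⟶ P, φ ≫ e.inv = e.inv ≫ DerivedCategory.Q.map f := by
    obtain ⟨f, hf⟩ := exists_Q_map_eq (e.hom ≫ φ ≫ e.inv)
    exact ⟨f, by rw [hf, Iso.inv_hom_id_assoc]⟩
  have hA (φ : L ⟶ L) (f : P ⟶ P) (hf : φ ≫ e.inv = e.inv ≫ DerivedCategory.Q.map f) (j : ℤ) :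
      (H j).map φ ≫ (eA j).hom = (eA j).hom ≫ HomologicalComplex.homologyMap f j := by
    have h1 := (DerivedCategory.homologyFunctorFactors (ModuleCat.{u} A) j).hom.naturality f
    change (H j).map φ ≫ (H j).map e.inv ≫ _ = ((H j).map e.inv ≫ _) ≫ _
    rw [← Category.assoc, ← Functor.map_comp, hf, Functor.map_comp, Category.assoc, Category.assoc]
    exact congrArg _ h1
  have hk (φ : L ⟶ L) (f : P ⟶ P) (hf : φ ≫ e.inv = e.inv ≫ DerivedCategory.Q.map f) :
      Hk.map (LT.map φ) ≫ ek.hom =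
        ek.hom ≫ HomologicalComplex.homologyMap (E.map f) i := by
    have h1 : Hk.map (DerivedCategory.Q.map (E.map f)) ≫ γ.hom =
        γ.hom ≫ HomologicalComplex.homologyMap (E.map f) i :=
      (DerivedCategory.homologyFunctorFactors
        (ModuleCat.{u} (ResidueField A)) i).hom.naturality (E.map f)
    have h2 : LT.map (DerivedCategory.Q.map f) ≫ β.hom =
      β.hom ≫ DerivedCategory.Q.map (E.map f) := α.naturality f
    change Hk.map (LT.map φ) ≫ Hk.map (LT.map e.inv ≫ β.hom) ≫ γ.hom =
      (Hk.map (LT.map e.inv ≫ β.hom) ≫ γ.hom) ≫ _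
    have h3 : LT.map φ ≫ LT.map e.inv ≫ β.hom =
        (LT.map e.inv ≫ β.hom) ≫ DerivedCategory.Q.map (E.map f) := by
      rw [← Category.assoc, ← Functor.map_comp, hf, Functor.map_comp, Category.assoc, h2,
        Category.assoc]
    rw [← Category.assoc, ← Functor.map_comp, h3, Functor.map_comp, Category.assoc, h1,
      Category.assoc]
  obtain ⟨a, b, h1, h2, h3, h4⟩ := exists_homology_reduction_sequence hϖ h0 P
    (fun n => by have := hproj n; infer_instance) i
  have inj {X Y : ModuleCat.{u} A} (s : X ≅ Y) : Function.Injective s.hom :=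
    (ModuleCat.mono_iff_injective _).1 inferInstance
  have inj' {X Y : ModuleCat.{u} A} (s : X ≅ Y) : Function.Injective s.inv :=
    (ModuleCat.mono_iff_injective _).1 inferInstance
  have hi {X Y : ModuleCat.{u} A} (s : X ≅ Y) (y : Y) : s.hom (s.inv y) = y :=
    ConcreteCategory.congr_hom s.inv_hom_id y
  refine ⟨(eA i).hom ≫ a ≫ (R.mapIso ek).inv, (R.mapIso ek).hom ≫ b ≫ (eA (i + 1)).inv,
    fun x => ?_, fun z => ?_, fun y => ?_, fun φ => ?_⟩
  · rw [ConcreteCategory.comp_apply, ConcreteCategory.comp_apply,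
      map_eq_zero_iff _ (inj' (R.mapIso ek)), h1]
    refine ⟨fun ⟨y, hy⟩ => ⟨(eA i).inv y, inj (eA i) ?_⟩, fun ⟨y, hy⟩ => ⟨(eA i).hom y, ?_⟩⟩
    · rw [map_smul, hi, hy]
    · rw [← hy, map_smul]
  · rw [ConcreteCategory.comp_apply, ConcreteCategory.comp_apply,
      map_eq_zero_iff _ (inj' (eA (i + 1))), h2]
    refine ⟨fun ⟨x, hx⟩ => ⟨(eA i).inv x, inj (R.mapIso ek) ?_⟩,
      fun ⟨x, hx⟩ => ⟨(eA i).hom x, ?_⟩⟩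
    · rw [ConcreteCategory.comp_apply, ConcreteCategory.comp_apply, hi, hi, hx]
    · rw [← hx, ConcreteCategory.comp_apply, ConcreteCategory.comp_apply, hi]
  · rw [← map_eq_zero_iff _ (inj (eA (i + 1))), map_smul, h3]
    refine ⟨fun ⟨z, hz⟩ => ⟨(R.mapIso ek).inv z, inj (eA (i + 1)) ?_⟩,
      fun ⟨z, hz⟩ => ⟨(R.mapIso ek).hom z, ?_⟩⟩
    · rw [ConcreteCategory.comp_apply, ConcreteCategory.comp_apply, hi, hi, hz]
    · rw [← hz, ConcreteCategory.comp_apply, ConcreteCategory.comp_apply, hi]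
  · obtain ⟨f, hf⟩ := hlift φ
    obtain ⟨h5, h6⟩ := h4 f
    have h7 : R.map (Hk.map (LT.map φ)) ≫ (R.mapIso ek).hom =
        (R.mapIso ek).hom ≫ R.map (HomologicalComplex.homologyMap (E.map f) i) := by
      change R.map _ ≫ R.map _ = R.map _ ≫ R.map _
      rw [← Functor.map_comp, hk φ f hf, Functor.map_comp]
    have h8 : R.map (HomologicalComplex.homologyMap (E.map f) i) ≫ (R.mapIso ek).inv =
        (R.mapIso ek).inv ≫ R.map (Hk.map (LT.map φ)) := by
      rw [Iso.comp_inv_eq, Category.assoc, h7, Iso.inv_hom_id_assoc]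
    have h9 : HomologicalComplex.homologyMap f (i + 1) ≫ (eA (i + 1)).inv =
        (eA (i + 1)).inv ≫ (H (i + 1)).map φ := by
      rw [Iso.comp_inv_eq, Category.assoc, hA φ f hf, Iso.inv_hom_id_assoc]
    constructor
    · change (H i).map φ ≫ _ = _ ≫ R.map (Hk.map (LT.map φ))
      rw [reassoc_of% (hA φ f hf i), Category.assoc, Category.assoc, ← h8]
      congr 1
      rw [← Category.assoc, h5, Category.assoc]
    · change R.map (Hk.map (LT.map φ)) ≫ _ = _ ≫ (H (i + 1)).map φ
      rw [reassoc_of% h7, Category.assoc, Category.assoc, ← h9]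
      congr 1
      rw [← Category.assoc, h6, Category.assoc]

end UniversalCoefficients

/-! ### Relations between classes in the Grothendieck group -/

section VirtualClass

variable {F : Type u} [Field F] {G : Type v} [Group G]
  {V₁ V₂ V₃ V₄ V₅ V₆ : Type u}
  [AddCommGroup V₁] [Module F V₁] [Module.Finite F V₁]
  [AddCommGroup V₂] [Module F V₂] [Module.Finite F V₂]
  [AddCommGroup V₃] [Module F V₃] [Module.Finite F V₃]
  [AddCommGroup V₄] [Module F V₄] [Module.Finite F V₄]
  [AddCommGroup V₅] [Module F V₅] [Module.Finite F V₅]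
  [AddCommGroup V₆] [Module F V₆] [Module.Finite F V₆]

theorem virtualClass_eq_add (ρ₁ : Representation F G V₁) (ρ₂ : Representation F G V₂)
    (ρ₃ : Representation F G V₃) (f : V₁ →ₗ[F] V₂) (g : V₂ →ₗ[F] V₃)
    (hf : ∀ s v, f (ρ₁ s v) = ρ₂ s (f v)) (hg : ∀ s v, g (ρ₂ s v) = ρ₃ s (g v))
    (hinj : Function.Injective f) (hex : Function.Exact f g) (hsurj : Function.Surjective g) :
    virtualClass ρ₂ = virtualClass ρ₁ + virtualClass ρ₃ := by
  have h : FreeAbelianGroup.of (FDRep.of ρ₂) - FreeAbelianGroup.of (FDRep.of ρ₁) -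
      FreeAbelianGroup.of (FDRep.of ρ₃) ∈ AddSubgroup.closure (exactRelations F G) :=
    AddSubgroup.subset_closure
      ⟨FDRep.of ρ₁, FDRep.of ρ₂, FDRep.of ρ₃, f, g, hf, hg, hinj, hex, hsurj, rfl⟩
  have h1 := (QuotientAddGroup.eq_zero_iff _).2 h
  rw [QuotientAddGroup.mk_sub, QuotientAddGroup.mk_sub, sub_sub, sub_eq_zero] at h1
  exact h1

/-- The exact sequence with three copies of the zero module gives `[V] = [V] + [V]`. -/
theorem virtualClass_of_subsingleton [Subsingleton V₁] (ρ : Representation F G V₁) :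
    virtualClass ρ = 0 := by
  have h := virtualClass_eq_add ρ ρ ρ 0 0 (fun _ _ => Subsingleton.elim _ _)
    (fun _ _ => Subsingleton.elim _ _) (fun _ _ _ => Subsingleton.elim _ _)
    (fun x => ⟨fun _ => ⟨0, Subsingleton.elim _ _⟩, fun _ => rfl⟩)
    (fun x => ⟨0, Subsingleton.elim _ _⟩)
  simpa using h

theorem virtualClass_congr (ρ₁ : Representation F G V₁) (ρ₂ : Representation F G V₂)
    (f : V₁ →ₗ[F] V₂) (hf : ∀ s v, f (ρ₁ s v) = ρ₂ s (f v)) (hbij : Function.Bijective f) :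
    virtualClass ρ₁ = virtualClass ρ₂ := by
  have h := virtualClass_eq_add ρ₁ ρ₂ (1 : Representation F G PUnit.{u + 1}) f 0 hf
    (fun _ _ => rfl) hbij.1 (fun x => ⟨fun _ => hbij.2 x, fun _ => rfl⟩)
    (fun x => ⟨0, rfl⟩)
  rw [h, virtualClass_of_subsingleton (1 : Representation F G PUnit.{u + 1}), add_zero]

end VirtualClass

section KerRange

variable {R : Type*} [CommRing R] {G : Type*} [Group G] {M N : Type*}
  [AddCommGroup M] [Module R M] [AddCommGroup N] [Module R N]

/-- The representation on a stable submodule. -/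
def restrictRep (ρ : Representation R G M) (W : Submodule R M)
    (h : ∀ s, ∀ v ∈ W, ρ s v ∈ W) : Representation R G W :=
  Subrepresentation.toRepresentation ⟨W, h⟩

/-- The representation on the kernel of an equivariant map. -/
def kerRep (ρ : Representation R G M) {σ : Representation R G N} {f : M →ₗ[R] N}
    (hf : ∀ s v, f (ρ s v) = σ s (f v)) : Representation R G (LinearMap.ker f) :=
  restrictRep ρ _ fun s v hv => by
    rw [LinearMap.mem_ker] at hv ⊢
    rw [hf, hv, map_zero]

/-- The representation on the range of an equivariant map. -/
def rangeRep {ρ : Representation R G M} (σ : Representation R G N) {f : M →ₗ[R] N}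
    (hf : ∀ s v, f (ρ s v) = σ s (f v)) : Representation R G (LinearMap.range f) :=
  restrictRep σ _ fun s v hv => by
    obtain ⟨x, rfl⟩ := hv
    exact ⟨ρ s x, hf s x⟩

end KerRange

section SixTerm

variable {F : Type u} [Field F] {G : Type v} [Group G]
  {V₁ V₂ V₃ V₄ V₅ V₆ : Type u}
  [AddCommGroup V₁] [Module F V₁] [Module.Finite F V₁]
  [AddCommGroup V₂] [Module F V₂] [Module.Finite F V₂]
  [AddCommGroup V₃] [Module F V₃] [Module.Finite F V₃]
  [AddCommGroup V₄] [Module F V₄] [Module.Finite F V₄]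
  [AddCommGroup V₅] [Module F V₅] [Module.Finite F V₅]
  [AddCommGroup V₆] [Module F V₆] [Module.Finite F V₆]

theorem virtualClass_eq_ker_add_range {W : Type u} [AddCommGroup W] [Module F W]
    (ρ₁ : Representation F G V₁) (ρ₂ : Representation F G W) (f : V₁ →ₗ[F] W) (hf : ∀ s v, f (ρ₁ s v) = ρ₂ s (f v)) :
    virtualClass ρ₁ = virtualClass (kerRep ρ₁ hf) + virtualClass (rangeRep ρ₂ hf) :=
  virtualClass_eq_add (kerRep ρ₁ hf) ρ₁ (rangeRep ρ₂ hf) (LinearMap.ker f).subtype f.rangeRestrict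
    (fun _ _ => rfl) (fun s v => Subtype.ext (hf s v)) Subtype.val_injective
    (fun x => ⟨fun h => ⟨⟨x, congrArg Subtype.val h⟩, rfl⟩,
      fun ⟨y, hy⟩ => Subtype.ext (hy ▸ y.2)⟩)
    f.surjective_rangeRestrict

theorem virtualClass_ker_eq_range {W : Type u} [AddCommGroup W] [Module F W]
    {ρ₁ : Representation F G V₁} {ρ₂ : Representation F G V₂}
    {ρ₃ : Representation F G W} {f : V₁ →ₗ[F] V₂} {g : V₂ →ₗ[F] W}
    (hf : ∀ s v, f (ρ₁ s v) = ρ₂ s (f v)) (hg : ∀ s v, g (ρ₂ s v) = ρ₃ s (g v))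
    (hex : Function.Exact f g) :
    virtualClass (kerRep ρ₂ hg) = virtualClass (rangeRep ρ₂ hf) :=
  virtualClass_congr _ _ (LinearEquiv.ofEq _ _ (LinearMap.exact_iff.1 hex)).toLinearMap
    (fun _ _ => rfl) (LinearEquiv.bijective _)

/-- The sequence is cut into short exact ones at the images of its maps. The conclusion is grouped
as cokernel minus kernel, the form needed for the snake lemma: the first three terms play the
kernels, the last three the cokernels. -/
theorem virtualClass_six_term {ρ₁ : Representation F G V₁} {ρ₂ : Representation F G V₂}
    {ρ₃ : Representation F G V₃} {ρ₄ : Representation F G V₄} {ρ₅ : Representation F G V₅}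
    {ρ₆ : Representation F G V₆} {f₁ : V₁ →ₗ[F] V₂} {f₂ : V₂ →ₗ[F] V₃} {f₃ : V₃ →ₗ[F] V₄}
    {f₄ : V₄ →ₗ[F] V₅} {f₅ : V₅ →ₗ[F] V₆}
    (h₁ : ∀ s v, f₁ (ρ₁ s v) = ρ₂ s (f₁ v)) (h₂ : ∀ s v, f₂ (ρ₂ s v) = ρ₃ s (f₂ v))
    (h₃ : ∀ s v, f₃ (ρ₃ s v) = ρ₄ s (f₃ v)) (h₄ : ∀ s v, f₄ (ρ₄ s v) = ρ₅ s (f₄ v))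
    (h₅ : ∀ s v, f₅ (ρ₅ s v) = ρ₆ s (f₅ v))
    (hinj : Function.Injective f₁) (h₁₂ : Function.Exact f₁ f₂) (h₂₃ : Function.Exact f₂ f₃)
    (h₃₄ : Function.Exact f₃ f₄) (h₄₅ : Function.Exact f₄ f₅) (hsurj : Function.Surjective f₅) :
    virtualClass ρ₅ - virtualClass ρ₂ = virtualClass ρ₄ - virtualClass ρ₁ +
      (virtualClass ρ₆ - virtualClass ρ₃) := by
  have e₂ := virtualClass_eq_add ρ₁ ρ₂ (rangeRep ρ₃ h₂) f₁ f₂.rangeRestrict h₁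
    (fun s v => Subtype.ext (h₂ s v)) hinj
    (fun x => ⟨fun h => (h₁₂ x).1 (congrArg Subtype.val h), fun h => Subtype.ext ((h₁₂ x).2 h)⟩)
    f₂.surjective_rangeRestrict
  have e₃ := virtualClass_eq_ker_add_range ρ₃ ρ₄ f₃ h₃
  have e₄ := virtualClass_eq_ker_add_range ρ₄ ρ₅ f₄ h₄
  have e₅ := virtualClass_eq_add (kerRep ρ₅ h₅) ρ₅ ρ₆ (LinearMap.ker f₅).subtype f₅
    (fun _ _ => rfl) h₅ Subtype.val_injective (fun x => ⟨fun h => ⟨⟨x, h⟩, rfl⟩,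
      fun ⟨y, hy⟩ => hy ▸ y.2⟩) hsurj
  rw [virtualClass_ker_eq_range h₂ h₃ h₂₃] at e₃
  rw [virtualClass_ker_eq_range h₃ h₄ h₃₄] at e₄
  rw [virtualClass_ker_eq_range h₄ h₅ h₄₅] at e₅
  rw [e₂, e₃, e₄, e₅]
  abel

end SixTerm

/-! ### The part of a module killed by the maximal ideal -/

section ResidueTorsion

variable (A : Type*) [CommRing A] [IsLocalRing A] (M : Type*) [AddCommGroup M] [Module A M]
  {N : Type*} [AddCommGroup N] [Module A N]

/-- The submodule of elements killed by the maximal ideal. -/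
def residueTorsion : Submodule A M := Submodule.torsionBySet A M (maximalIdeal A)

instance : Module (ResidueField A) (residueTorsion A M) :=
  inferInstanceAs (Module (A ⧸ maximalIdeal A) (Submodule.torsionBySet A M (maximalIdeal A)))

instance : IsScalarTower A (ResidueField A) (residueTorsion A M) :=
  inferInstanceAs (IsScalarTower A (A ⧸ maximalIdeal A)
    (Submodule.torsionBySet A M (maximalIdeal A)))

instance [IsNoetherianRing A] [Module.Finite A M] :
    Module.Finite (ResidueField A) (residueTorsion A M) :=
  Module.Finite.of_restrictScalars_finite A _ _

variable {A M}

theorem mem_residueTorsion_iff {ϖ : A} (hϖ : maximalIdeal A = Ideal.span {ϖ}) {x : M} :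
    x ∈ residueTorsion A M ↔ ϖ • x = 0 := by
  rw [residueTorsion, hϖ, ← Submodule.torsionBySet_eq_torsionBySet_span,
    Submodule.torsionBySet_singleton_eq, Submodule.mem_torsionBy_iff]

theorem map_mem_residueTorsion (f : M →ₗ[A] N) {x : M} (hx : x ∈ residueTorsion A M) :
    f x ∈ residueTorsion A N := by
  rw [residueTorsion, Submodule.mem_torsionBySet_iff] at hx ⊢
  exact fun a => by rw [← map_smul, hx, map_zero]

/-- The `k`-linear map between the submodules killed by the maximal ideal which is induced by a
linear map. -/
noncomputable def residueTorsionMap (f : M →ₗ[A] N) :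
    residueTorsion A M →ₗ[ResidueField A] residueTorsion A N :=
  (f.restrict fun _ => map_mem_residueTorsion f).extendScalarsOfSurjective residue_surjective

/-- The representation on the submodule killed by the maximal ideal. -/
noncomputable def residueTorsionRep {G : Type*} [Group G] (ρ : Representation A G M) :
    Representation (ResidueField A) G (residueTorsion A M) where
  toFun g := residueTorsionMap (ρ g)
  map_one' := by
    ext x
    change (ρ 1 x : M) = x
    simp
  map_mul' g h := by
    ext x
    change (ρ (g * h) x : M) = ρ g (ρ h x)
    simp

end ResidueTorsion

section BaseChangeRep

variable {A : Type*} [CommRing A] {G : Type*} [Group G] {M₁ M₂ : Type*}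
  [AddCommGroup M₁] [Module A M₁] [AddCommGroup M₂] [Module A M₂]

theorem baseChange_equivariant (B : Type*) [CommRing B] [Algebra A B]
    {ρ₁ : Representation A G M₁} {ρ₂ : Representation A G M₂} {f : M₁ →ₗ[A] M₂}
    (hf : ∀ s v, f (ρ₁ s v) = ρ₂ s (f v)) (s : G) (v : B ⊗[A] M₁) :
    f.baseChange B (baseChangeRep B ρ₁ s v) = baseChangeRep B ρ₂ s (f.baseChange B v) := by
  have h : f ∘ₗ ρ₁ s = ρ₂ s ∘ₗ f := LinearMap.ext (hf s)
  have := congrArg (LinearMap.baseChange B) h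
  rw [LinearMap.baseChange_comp, LinearMap.baseChange_comp] at this
  exact LinearMap.congr_fun this v

end BaseChangeRep

/-! ### Additivity of the reduction class and its vanishing on torsion -/

section ReductionClass

variable {A : Type u} [CommRing A] [IsLocalRing A] [IsNoetherianRing A] {G : Type v} [Group G]
  {M M₁ M₂ M₃ : Type u}
  [AddCommGroup M] [Module A M] [Module.Finite A M]
  [AddCommGroup M₁] [Module A M₁] [Module.Finite A M₁]
  [AddCommGroup M₂] [Module A M₂] [Module.Finite A M₂]
  [AddCommGroup M₃] [Module A M₃] [Module.Finite A M₃]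

/-- The class of `M ⊗ᴸ k` in the Grothendieck group, `M` a finitely generated `A`-module on which
`G` acts: for principal maximal ideal it is the class of `M ⊗ k` minus the class of the submodule
of `M` killed by the maximal ideal. -/
noncomputable def reductionClass (ρ : Representation A G M) : VirtualModule (ResidueField A) G :=
  virtualClass (baseChangeRep (ResidueField A) ρ) - virtualClass (residueTorsionRep ρ)

/-- Snake lemma for multiplication by `ϖ` on the three terms: the kernels are the `residueTorsion`
modules and the cokernels are the tensor products with the residue field. -/
theorem reductionClass_eq_add {ϖ : A} (hϖ : maximalIdeal A = Ideal.span {ϖ})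
    (ρ₁ : Representation A G M₁) (ρ₂ : Representation A G M₂)
    (ρ₃ : Representation A G M₃) (f : M₁ →ₗ[A] M₂) (g : M₂ →ₗ[A] M₃)
    (hf : ∀ s v, f (ρ₁ s v) = ρ₂ s (f v)) (hg : ∀ s v, g (ρ₂ s v) = ρ₃ s (g v))
    (hinj : Function.Injective f) (hex : Function.Exact f g) (hsurj : Function.Surjective g) :
    reductionClass ρ₂ = reductionClass ρ₁ + reductionClass ρ₃ := by
  let m (X : Type u) [AddCommGroup X] [Module A X] : X →ₗ[A] X := ϖ • LinearMap.id
  let ι (X : Type u) [AddCommGroup X] [Module A X] : residueTorsion A X →ₗ[A] X :=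
    (residueTorsion A X).subtype
  let π (X : Type u) [AddCommGroup X] [Module A X] : X →ₗ[A] ResidueField A ⊗[A] X :=
    TensorProduct.mk A (ResidueField A) X 1
  have hι (X : Type u) [AddCommGroup X] [Module A X] : Function.Exact (ι X) (m X) := fun x =>
    ⟨fun h => ⟨⟨x, (mem_residueTorsion_iff hϖ).2 h⟩, rfl⟩,
      fun ⟨y, hy⟩ => hy ▸ (mem_residueTorsion_iff hϖ).1 y.2⟩
  have hπ (X : Type u) [AddCommGroup X] [Module A X] : Function.Exact (m X) (π X) := fun x =>
    one_tmul_eq_zero_iff hϖ x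
  have hm {X Y : Type u} [AddCommGroup X] [Module A X] [AddCommGroup Y] [Module A Y]
      (φ : X →ₗ[A] Y) : φ.comp (m X) = (m Y).comp φ := by
    ext x
    simp [m]
  let δ : residueTorsion A M₃ →ₗ[A] ResidueField A ⊗[A] M₁ :=
    SnakeLemma.δ' (m M₁) (m M₂) (m M₃) f g hex f g hex (hm f) (hm g) (ι M₃) (hι M₃) (π M₁) (hπ M₁)
      hsurj hinj
  have hδ (x : residueTorsion A M₃) (y : M₂) (hy : g y = x) (z : M₁) (hz : f z = ϖ • y) :
      δ x = π M₁ z := SnakeLemma.δ'_eq _ _ _ _ _ _ _ _ _ _ _ _ _ _ _ _ _ _ _ hy _ hz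
  have h23 : Function.Exact (residueTorsionMap g) δ :=
    SnakeLemma.exact_δ'_right _ _ _ _ _ _ _ _ _ _ _ (ι M₂) (hι M₂) _ _ _ _ _ _
      ((residueTorsionMap g).restrictScalars A) rfl Subtype.val_injective
  have h34 : Function.Exact δ (f.baseChange (ResidueField A)) :=
    SnakeLemma.exact_δ'_left _ _ _ _ _ _ _ _ _ _ _ _ _ _ _ (π M₂) (hπ M₂) _ _
      ((f.baseChange (ResidueField A)).restrictScalars A) (by ext x; rfl) (one_tmul_surjective _)
  refine virtualClass_six_term (ρ₁ := residueTorsionRep ρ₁)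
    (f₁ := residueTorsionMap f) (f₂ := residueTorsionMap g)
    (f₃ := δ.extendScalarsOfSurjective residue_surjective)
    (f₄ := f.baseChange (ResidueField A)) (f₅ := g.baseChange (ResidueField A))
    (fun s v => Subtype.ext (hf s v)) (fun s v => Subtype.ext (hg s v)) (fun s v => ?_)
    (baseChange_equivariant _ hf) (baseChange_equivariant _ hg)
    (fun x y h => Subtype.ext (hinj (congrArg Subtype.val h)))
    (fun x => ⟨fun h => ?_, fun ⟨y, hy⟩ => ?_⟩) h23 h34
    (lTensor_exact (ResidueField A) hex hsurj) (LinearMap.lTensor_surjective _ hsurj)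
  -- Equivariance of the connecting map: it may be computed from any lifts, and `ρ₂ s y`, `ρ₁ s z`
  -- are lifts for the translate of `v`.
  · obtain ⟨y, hy⟩ := hsurj v
    obtain ⟨z, hz⟩ : ∃ z, f z = ϖ • y := (hex _).1 (by
      rw [map_smul, hy]
      exact (mem_residueTorsion_iff hϖ).1 v.2)
    have e1 : δ v = π M₁ z := hδ v y hy z hz
    have e2 : δ (residueTorsionRep ρ₃ s v) = π M₁ (ρ₁ s z) :=
      hδ _ (ρ₂ s y) (by rw [hg, hy]; rfl) _ (by rw [hf, hz, map_smul])
    change δ (residueTorsionRep ρ₃ s v) = baseChangeRep (ResidueField A) ρ₁ s (δ v)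
    rw [e1, e2]
    rfl
  · obtain ⟨y, hy⟩ := (hex x).1 (congrArg Subtype.val h)
    refine ⟨⟨y, (mem_residueTorsion_iff hϖ).2 (hinj ?_)⟩, Subtype.ext hy⟩
    rw [map_smul, hy, map_zero]
    exact (mem_residueTorsion_iff hϖ).1 x.2
  · subst hy
    exact Subtype.ext ((hex _).2 ⟨y, rfl⟩)

theorem reductionClass_eq_ker_add_range {ϖ : A} (hϖ : maximalIdeal A = Ideal.span {ϖ})
    {N : Type u} [AddCommGroup N] [Module A N]
    (ρ₁ : Representation A G M₁) (ρ₂ : Representation A G N)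
    (f : M₁ →ₗ[A] N) (hf : ∀ s v, f (ρ₁ s v) = ρ₂ s (f v)) :
    reductionClass ρ₁ = reductionClass (kerRep ρ₁ hf) + reductionClass (rangeRep ρ₂ hf) :=
  reductionClass_eq_add hϖ (kerRep ρ₁ hf) ρ₁ (rangeRep ρ₂ hf) (LinearMap.ker f).subtype
    f.rangeRestrict (fun _ _ => rfl) (fun s v => Subtype.ext (hf s v)) Subtype.val_injective
    (fun x => ⟨fun h => ⟨⟨x, congrArg Subtype.val h⟩, rfl⟩,
      fun ⟨y, hy⟩ => Subtype.ext (hy ▸ y.2)⟩)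
    f.surjective_rangeRestrict

/-- If `ϖ` kills `M`, then `M[ϖ] = M = M / ϖM`, so the two terms of the reduction class cancel. -/
theorem reductionClass_of_smul_eq_zero {ϖ : A} (hϖ : maximalIdeal A = Ideal.span {ϖ})
    (ρ : Representation A G M) (h : ∀ x : M, ϖ • x = 0) : reductionClass ρ = 0 := by
  rw [reductionClass, sub_eq_zero]
  refine (virtualClass_congr (residueTorsionRep ρ) _
    ((TensorProduct.mk A (ResidueField A) M 1 ∘ₗ
      (residueTorsion A M).subtype).extendScalarsOfSurjective residue_surjective)
    (fun s v => rfl) ⟨?_, fun y => ?_⟩).symm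
  · refine (injective_iff_map_eq_zero _).2 fun x hx => ?_
    obtain ⟨y, hy⟩ := (one_tmul_eq_zero_iff hϖ (x : M)).1 hx
    exact Subtype.ext (hy ▸ h y)
  · obtain ⟨x, rfl⟩ := one_tmul_surjective M y
    exact ⟨⟨x, (mem_residueTorsion_iff hϖ).2 (h x)⟩, rfl⟩

/-- Dévissage along multiplication by `ϖ`: its kernel is killed by `ϖ`, and its image by one power
fewer. -/
theorem reductionClass_of_pow_smul_eq_zero {ϖ : A} (hϖ : maximalIdeal A = Ideal.span {ϖ})
    (n : ℕ) (ρ : Representation A G M) (h : ∀ x : M, ϖ ^ n • x = 0) : reductionClass ρ = 0 := by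
  induction n generalizing M with
  | zero =>
    refine reductionClass_of_smul_eq_zero hϖ ρ fun x => ?_
    have hx : x = 0 := by simpa using h x
    rw [hx, smul_zero]
  | succ n ih =>
    have hm (s : G) (v : M) : (ϖ • LinearMap.id : M →ₗ[A] M) (ρ s v) =
        ρ s ((ϖ • LinearMap.id : M →ₗ[A] M) v) := by simp
    rw [reductionClass_eq_ker_add_range hϖ ρ ρ _ hm,
      reductionClass_of_smul_eq_zero hϖ _ fun x => Subtype.ext x.2, ih, add_zero]
    rintro ⟨_, x, rfl⟩
    exact Subtype.ext (by simpa [pow_succ, mul_smul] using h x)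

theorem reductionClass_eq_of_isogeny {ϖ : A} (hϖ : maximalIdeal A = Ideal.span {ϖ})
    (ρ₁ : Representation A G M₁) (ρ₂ : Representation A G M₂)
    (f : M₁ →ₗ[A] M₂) (hf : ∀ s v, f (ρ₁ s v) = ρ₂ s (f v)) (m n : ℕ)
    (hker : ∀ x, f x = 0 → ϖ ^ m • x = 0) (hcoker : ∀ y, ∃ x, f x = ϖ ^ n • y) :
    reductionClass ρ₁ = reductionClass ρ₂ := by
  have hle (s : G) : LinearMap.range f ≤ (LinearMap.range f).comap (ρ₂ s) := by
    rintro _ ⟨x, rfl⟩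
    exact ⟨ρ₁ s x, hf s x⟩
  have h := reductionClass_eq_add hϖ (rangeRep ρ₂ hf) ρ₂ (ρ₂.quotient _ hle)
    (LinearMap.range f).subtype (LinearMap.range f).mkQ (fun _ _ => rfl) (fun _ _ => rfl)
    Subtype.val_injective (LinearMap.exact_subtype_mkQ _) (Submodule.mkQ_surjective _)
  rw [h, reductionClass_eq_ker_add_range hϖ ρ₁ ρ₂ f hf,
    reductionClass_of_pow_smul_eq_zero hϖ m _ fun x => Subtype.ext (hker x x.2),
    reductionClass_of_pow_smul_eq_zero hϖ n (ρ₂.quotient _ hle), zero_add, add_zero]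
  intro y
  obtain ⟨y, rfl⟩ := Submodule.mkQ_surjective _ y
  obtain ⟨x, hx⟩ := hcoker y
  rw [← map_smul, ← hx]
  exact (Submodule.Quotient.mk_eq_zero _).2 ⟨x, rfl⟩

end ReductionClass

section Torsion

variable {A : Type*} [CommRing A] [IsDomain A] [IsDiscreteValuationRing A]
  {N : Type*} [AddCommGroup N] [Module A N] [Module.Finite A N]

/-- A finitely generated torsion module has a nonzero annihilator, which in a discrete valuation
ring is a power of `ϖ` up to a unit. -/
theorem exists_pow_smul_eq_zero {ϖ : A} (hϖ : Irreducible ϖ)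
    (h : ∀ x : N, ∃ a : A, a ≠ 0 ∧ a • x = 0) : ∃ n : ℕ, ∀ x : N, ϖ ^ n • x = 0 := by
  have htors : Module.IsTorsion A N := fun x => by
    obtain ⟨a, ha, hx⟩ := h x
    exact ⟨⟨a, mem_nonZeroDivisors_of_ne_zero ha⟩, hx⟩
  obtain ⟨a, ha, ha'⟩ := Submodule.annihilator_top_inter_nonZeroDivisors htors
  obtain ⟨n, u, hu⟩ := IsDiscreteValuationRing.associated_pow_irreducible
    (nonZeroDivisors.ne_zero ha') hϖ
  refine ⟨n, fun x => ?_⟩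
  rw [← hu, mul_comm, mul_smul, Submodule.mem_annihilator.1 ha x trivial, smul_zero]

end Torsion

/-! ### Stable lattices and independence of the lattice -/

section StableLattice

variable {A : Type*} [CommRing A] {G : Type*} [Group G] {K : Type*} [Field K]
  {V : Type*} [AddCommGroup V] [Module K V] [Module A V]

/-- A `G`-stable lattice in a representation over the fraction field. -/
structure IsStableLattice (σ : Representation K G V) (X : Submodule A V) : Prop where
  finite : Module.Finite A X
  stable : ∀ s, ∀ v ∈ X, σ s v ∈ X
  exists_smul_mem : ∀ v, ∃ a : A, a ≠ 0 ∧ a • v ∈ X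

theorem IsStableLattice.sup {σ : Representation K G V} {X Y : Submodule A V}
    (hX : IsStableLattice σ X) (hY : IsStableLattice σ Y) : IsStableLattice σ (X ⊔ Y) where
  finite := by
    have := hX.finite
    have := hY.finite
    infer_instance
  stable s v hv := by
    obtain ⟨x, hx, y, hy, rfl⟩ := Submodule.mem_sup.1 hv
    rw [map_add]
    exact Submodule.add_mem_sup (hX.stable s x hx) (hY.stable s y hy)
  exists_smul_mem v := by
    obtain ⟨a, ha, h⟩ := hX.exists_smul_mem v
    exact ⟨a, ha, Submodule.mem_sup_left h⟩

/-- The representation on a stable lattice. -/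
def IsStableLattice.rep [Algebra A K] [IsScalarTower A K V] {σ : Representation K G V} {X : Submodule A V}
    (hX : IsStableLattice σ X) : Representation A G X where
  toFun s := ((σ s).restrictScalars A).restrict (hX.stable s)
  map_one' := by ext; simp
  map_mul' x y := by ext; simp; rfl

theorem isLocalizedModule_one_tmul [Algebra A K] [IsFractionRing A K] (M : Type*) [AddCommGroup M] [Module A M] :
    IsLocalizedModule (nonZeroDivisors A) (TensorProduct.mk A K M 1) :=
  (isLocalizedModule_iff_isBaseChange (nonZeroDivisors A) K _).2
    (TensorProduct.isBaseChange A M K)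

end StableLattice

section Lattices

variable {A : Type u} [CommRing A] [IsDomain A] [IsDiscreteValuationRing A] {G : Type v} [Group G]
  {M M₁ M₂ M₃ : Type u}
  [AddCommGroup M] [Module A M] [Module.Finite A M]
  [AddCommGroup M₁] [Module A M₁] [Module.Finite A M₁]
  [AddCommGroup M₂] [Module A M₂] [Module.Finite A M₂]
  [AddCommGroup M₃] [Module A M₃] [Module.Finite A M₃]

/-- Kernel and cokernel are finitely generated torsion modules, hence killed by powers of `ϖ` and
invisible to `reductionClass`. -/
theorem reductionClass_eq_of_torsion
    (ρ₁ : Representation A G M₁) (ρ₂ : Representation A G M₂)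
    (f : M₁ →ₗ[A] M₂) (hf : ∀ s v, f (ρ₁ s v) = ρ₂ s (f v))
    (hker : ∀ x, f x = 0 → ∃ a : A, a ≠ 0 ∧ a • x = 0)
    (hcoker : ∀ y, ∃ a : A, a ≠ 0 ∧ ∃ x, f x = a • y) :
    reductionClass ρ₁ = reductionClass ρ₂ := by
  obtain ⟨ϖ, hϖ⟩ := IsDiscreteValuationRing.exists_irreducible A
  obtain ⟨m, hm⟩ := exists_pow_smul_eq_zero (N := LinearMap.ker f) hϖ fun x => by
    obtain ⟨a, ha, hx⟩ := hker x x.2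
    exact ⟨a, ha, Subtype.ext hx⟩
  obtain ⟨n, hn⟩ := exists_pow_smul_eq_zero (N := M₂ ⧸ LinearMap.range f) hϖ fun y => by
    obtain ⟨y, rfl⟩ := Submodule.mkQ_surjective _ y
    obtain ⟨a, ha, x, hx⟩ := hcoker y
    refine ⟨a, ha, ?_⟩
    rw [← map_smul, ← hx]
    exact (Submodule.Quotient.mk_eq_zero _).2 ⟨x, rfl⟩
  refine reductionClass_eq_of_isogeny hϖ.maximalIdeal_eq ρ₁ ρ₂ f hf m n
    (fun x hx => congrArg Subtype.val (hm ⟨x, hx⟩)) fun y => ?_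
  exact (Submodule.Quotient.mk_eq_zero _).1 (hn (Submodule.Quotient.mk y))

variable {K : Type u} [Field K] [Algebra A K]
  {V V₁ V₂ V₃ : Type u}
  [AddCommGroup V] [Module K V] [Module A V] [IsScalarTower A K V]
  [AddCommGroup V₁] [Module K V₁] [Module A V₁] [IsScalarTower A K V₁]
  [AddCommGroup V₂] [Module K V₂] [Module A V₂] [IsScalarTower A K V₂]
  [AddCommGroup V₃] [Module K V₃] [Module A V₃] [IsScalarTower A K V₃]

/-- The class of the reduction of a stable lattice. -/
noncomputable def IsStableLattice.latticeClass {σ : Representation K G V} {X : Submodule A V}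
    (hX : IsStableLattice σ X) : VirtualModule (ResidueField A) G :=
  have := hX.finite
  reductionClass hX.rep

theorem IsStableLattice.latticeClass_eq_of_le {σ : Representation K G V} {X Y : Submodule A V}
    (hX : IsStableLattice σ X) (hY : IsStableLattice σ Y) (h : X ≤ Y) : hX.latticeClass = hY.latticeClass := by
  have := hX.finite
  have := hY.finite
  refine reductionClass_eq_of_torsion hX.rep hY.rep (Submodule.inclusion h) (fun s v => rfl)
    (fun x hx => ⟨1, one_ne_zero, ?_⟩) fun y => ?_
  · rw [one_smul]
    exact Submodule.inclusion_injective h (hx.trans (map_zero _).symm)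
  · obtain ⟨a, ha, hy⟩ := hX.exists_smul_mem y
    exact ⟨a, ha, ⟨_, hy⟩, rfl⟩

/-- Two lattices are compared through their sum, which contains both with torsion quotients. -/
theorem IsStableLattice.latticeClass_eq {σ : Representation K G V} {X Y : Submodule A V}
    (hX : IsStableLattice σ X) (hY : IsStableLattice σ Y) : hX.latticeClass = hY.latticeClass :=
  (hX.latticeClass_eq_of_le (hX.sup hY) le_sup_left).trans
    (hY.latticeClass_eq_of_le (hX.sup hY) le_sup_right).symm

/-- By independence of the lattice, `X₁` and `X₃` may be replaced by the preimage and the image of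
`X₂`; these form an exact sequence with `X₂`. -/
theorem IsStableLattice.latticeClass_eq_add {σ₁ : Representation K G V₁} {σ₂ : Representation K G V₂}
    {σ₃ : Representation K G V₃} {X₁ : Submodule A V₁} {X₂ : Submodule A V₂} {X₃ : Submodule A V₃}
    (hX₁ : IsStableLattice σ₁ X₁) (hX₂ : IsStableLattice σ₂ X₂) (hX₃ : IsStableLattice σ₃ X₃)
    (f : V₁ →ₗ[K] V₂) (g : V₂ →ₗ[K] V₃)
    (hf : ∀ s v, f (σ₁ s v) = σ₂ s (f v)) (hg : ∀ s v, g (σ₂ s v) = σ₃ s (g v))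
    (hinj : Function.Injective f) (hex : Function.Exact f g) (hsurj : Function.Surjective g) :
    hX₂.latticeClass = hX₁.latticeClass + hX₃.latticeClass := by
  obtain ⟨ϖ, hϖ⟩ := IsDiscreteValuationRing.exists_irreducible A
  have := hX₂.finite
  let f' : X₂.comap (f.restrictScalars A) →ₗ[A] X₂ :=
    (f.restrictScalars A).restrict fun _ hx => hx
  let g' : X₂ →ₗ[A] X₂.map (g.restrictScalars A) :=
    (g.restrictScalars A).restrict fun _ hx => Submodule.mem_map_of_mem hx
  have hf' : Function.Injective f' := fun x y h => Subtype.ext (hinj (congrArg Subtype.val h))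
  have hY₁ : IsStableLattice σ₁ (X₂.comap (f.restrictScalars A)) :=
    { finite := Module.Finite.of_injective f' hf'
      stable := fun s v hv => by
        rw [Submodule.mem_comap, LinearMap.restrictScalars_apply, hf]
        exact hX₂.stable s _ hv
      exists_smul_mem := fun v => by
        obtain ⟨a, ha, h⟩ := hX₂.exists_smul_mem (f v)
        exact ⟨a, ha, by rwa [Submodule.mem_comap, map_smul]⟩ }
  have hY₃ : IsStableLattice σ₃ (X₂.map (g.restrictScalars A)) :=
    { finite := inferInstance
      stable := by
        rintro s _ ⟨v, hv, rfl⟩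
        exact ⟨σ₂ s v, hX₂.stable s v hv, hg s v⟩
      exists_smul_mem := fun v => by
        obtain ⟨v, rfl⟩ := hsurj v
        obtain ⟨a, ha, h⟩ := hX₂.exists_smul_mem v
        exact ⟨a, ha, a • v, h, map_smul (g.restrictScalars A) a v⟩ }
  rw [hX₁.latticeClass_eq hY₁, hX₃.latticeClass_eq hY₃]
  have := hY₁.finite
  have := hY₃.finite
  refine reductionClass_eq_add hϖ.maximalIdeal_eq hY₁.rep hX₂.rep hY₃.rep f' g'
    (fun s v => Subtype.ext (hf s v)) (fun s v => Subtype.ext (hg s v)) hf'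
    (fun x => ⟨fun h => ?_, fun ⟨y, hy⟩ => ?_⟩) ?_
  · obtain ⟨y, hy⟩ := (hex x).1 (congrArg Subtype.val h)
    exact ⟨⟨y, by rw [Submodule.mem_comap, LinearMap.restrictScalars_apply, hy]; exact x.2⟩,
      Subtype.ext hy⟩
  · subst hy
    exact Subtype.ext ((hex _).2 ⟨y, rfl⟩)
  · rintro ⟨_, x, hx, rfl⟩
    exact ⟨⟨x, hx⟩, rfl⟩

variable [IsFractionRing A K]

/-- The image of `M` in `K ⊗ M` is a stable lattice. -/
theorem isStableLattice_range (ρ : Representation A G M) :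
    IsStableLattice (baseChangeRep K ρ) (LinearMap.range (TensorProduct.mk A K M 1)) where
  finite := inferInstance
  stable := by
    rintro s _ ⟨x, rfl⟩
    exact ⟨ρ s x, rfl⟩
  exists_smul_mem v := by
    have := isLocalizedModule_one_tmul (A := A) (K := K) M
    obtain ⟨⟨x, a⟩, h⟩ := IsLocalizedModule.surj (nonZeroDivisors A) (TensorProduct.mk A K M 1) v
    exact ⟨a, nonZeroDivisors.ne_zero a.2, x, h.symm⟩

theorem latticeClass_isStableLattice_range (ρ : Representation A G M) :
    (isStableLattice_range (K := K) ρ).latticeClass = reductionClass ρ := by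
  refine (reductionClass_eq_of_torsion ρ _
    (TensorProduct.mk A K M 1).rangeRestrict (fun s v => rfl) (fun x hx => ?_) fun y => ?_).symm
  · have := isLocalizedModule_one_tmul (A := A) (K := K) M
    obtain ⟨a, ha⟩ := (IsLocalizedModule.eq_zero_iff (nonZeroDivisors A)
      (TensorProduct.mk A K M 1)).1 (congrArg Subtype.val hx)
    exact ⟨a, nonZeroDivisors.ne_zero a.2, ha⟩
  · obtain ⟨x, hx⟩ := (TensorProduct.mk A K M 1).surjective_rangeRestrict y
    exact ⟨1, one_ne_zero, x, by rw [hx, one_smul]⟩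

/-- The maps `f` and `g` exist only over `K` and need not preserve the images of the `Mᵢ`; passing
to lattices removes this obstacle. -/
theorem reductionClass_eq_add_of_baseChange
    (ρ₁ : Representation A G M₁) (ρ₂ : Representation A G M₂) (ρ₃ : Representation A G M₃)
    (f : K ⊗[A] M₁ →ₗ[K] K ⊗[A] M₂) (g : K ⊗[A] M₂ →ₗ[K] K ⊗[A] M₃)
    (hf : ∀ s v, f (baseChangeRep K ρ₁ s v) = baseChangeRep K ρ₂ s (f v))
    (hg : ∀ s v, g (baseChangeRep K ρ₂ s v) = baseChangeRep K ρ₃ s (g v))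
    (hinj : Function.Injective f) (hex : Function.Exact f g) (hsurj : Function.Surjective g) :
    reductionClass ρ₂ = reductionClass ρ₁ + reductionClass ρ₃ := by
  rw [← latticeClass_isStableLattice_range (K := K) ρ₁, ← latticeClass_isStableLattice_range (K := K) ρ₂,
    ← latticeClass_isStableLattice_range (K := K) ρ₃]
  exact IsStableLattice.latticeClass_eq_add _ _ _ f g hf hg hinj hex hsurj

end Lattices

/-! ### The decomposition homomorphism -/

section Decomposition

variable {A : Type u} [CommRing A] [IsDomain A] [IsDiscreteValuationRing A]
  {K : Type u} [Field K] [Algebra A K] [IsFractionRing A K] {G : Type v} [Group G]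

/-- The `A`-span of all `G`-translates of a `K`-basis is stable, and finitely generated because `G`
is finite. Clearing denominators brings any vector into it. -/
theorem exists_isStableLattice [Finite G] {V : Type u} [AddCommGroup V] [Module K V] [Module A V]
    [IsScalarTower A K V] [Module.Finite K V] (σ : Representation K G V) :
    ∃ X : Submodule A V, IsStableLattice σ X := by
  let b := Module.finBasis K V
  let S : Set V := Set.range fun x : G × Fin (Module.finrank K V) => σ x.1 (b x.2)
  refine ⟨Submodule.span A S, Module.Finite.span_of_finite A (Set.finite_range _), fun s v hv => ?_,
    fun v => ?_⟩
  · induction hv using Submodule.span_induction with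
    | mem x hx =>
      obtain ⟨⟨t, i⟩, rfl⟩ := hx
      refine Submodule.subset_span ⟨(s * t, i), ?_⟩
      simp
    | zero => simp
    | add x y _ _ hx hy => rw [map_add]; exact add_mem hx hy
    | smul a x _ hx =>
      rw [← algebraMap_smul K a x, map_smul, algebraMap_smul]
      exact Submodule.smul_mem _ a hx
  · have hv : v ∈ Submodule.span K (Set.range b) := by rw [b.span_eq]; trivial
    induction hv using Submodule.span_induction with
    | mem x hx =>
      obtain ⟨i, rfl⟩ := hx
      refine ⟨1, one_ne_zero, ?_⟩
      rw [one_smul]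
      exact Submodule.subset_span ⟨(1, i), by simp⟩
    | zero => exact ⟨1, one_ne_zero, by simp⟩
    | add x y _ _ hx hy =>
      obtain ⟨a, ha, hx⟩ := hx
      obtain ⟨c, hc, hy⟩ := hy
      refine ⟨a * c, mul_ne_zero ha hc, ?_⟩
      rw [smul_add, mul_comm a c, mul_smul, mul_comm c a, mul_smul]
      exact add_mem (Submodule.smul_mem _ _ hx) (Submodule.smul_mem _ _ hy)
    | smul c x _ hx =>
      obtain ⟨a, ha, hx⟩ := hx
      obtain ⟨r, d, hd, rfl⟩ := IsFractionRing.div_surjective (A := A) c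
      refine ⟨d * a, mul_ne_zero (nonZeroDivisors.ne_zero hd) ha, ?_⟩
      have hd' : algebraMap A K d ≠ 0 := IsFractionRing.to_map_ne_zero_of_mem_nonZeroDivisors hd
      have : (d * a) • (algebraMap A K r / algebraMap A K d) • x = r • a • x := by
        simp only [← algebraMap_smul K (_ : A) (_ : V), smul_smul, map_mul]
        congr 1
        field_simp
      rw [this]
      exact Submodule.smul_mem _ _ hx

/-- Every finite-dimensional representation over the fraction field is obtained by base change from
a free module. -/
theorem exists_lattice [Finite G] {V : Type u} [AddCommGroup V] [Module K V]
    [Module.Finite K V] (σ : Representation K G V) :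
    ∃ (Λ : Type u) (_ : AddCommGroup Λ) (_ : Module A Λ) (_ : Module.Free A Λ)
      (_ : Module.Finite A Λ) (ρ : Representation A G Λ) (e : K ⊗[A] Λ ≃ₗ[K] V),
      ∀ s v, e (baseChangeRep K ρ s v) = σ s (e v) := by
  let _ : Module A V := Module.compHom V (algebraMap A K)
  have : IsScalarTower A K V := IsScalarTower.of_algebraMap_smul fun _ _ => rfl
  obtain ⟨X, hX⟩ := exists_isStableLattice (A := A) σ
  have := hX.finite
  have hreg (a : A) (ha : a ≠ 0) : Function.Bijective fun v : V => a • v := by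
    have ha' : algebraMap A K a ≠ 0 := fun h => ha ((IsFractionRing.injective A K) (by simpa using h))
    exact MulAction.bijective (Units.mk0 _ ha')
  -- A finitely generated torsion-free module over a principal ideal domain is free; this is what
  -- makes the lattice `X` free.
  have : Module.IsTorsionFree A V := ⟨fun a ha => (hreg a ha.ne_zero).1⟩
  have hloc : IsLocalizedModule (nonZeroDivisors A) X.subtype :=
    { map_units := fun a => (Module.End.isUnit_iff _).2 (hreg a (nonZeroDivisors.ne_zero a.2))
      surj := fun v => by
        obtain ⟨a, ha, h⟩ := hX.exists_smul_mem v
        exact ⟨(⟨_, h⟩, ⟨a, mem_nonZeroDivisors_of_ne_zero ha⟩), rfl⟩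
      exists_of_eq := fun h => ⟨1, by rw [Subtype.ext h]⟩ }
  have hbc := (isLocalizedModule_iff_isBaseChange (nonZeroDivisors A) K X.subtype).1 hloc
  refine ⟨X, inferInstance, inferInstance, inferInstance, inferInstance, hX.rep, hbc.equiv,
    fun s v => ?_⟩
  induction v using TensorProduct.induction_on with
  | zero => simp
  | add x y hx hy => simp only [map_add, hx, hy]
  | tmul c x =>
    change hbc.equiv (c ⊗ₜ hX.rep s x) = _
    rw [IsBaseChange.equiv_tmul, IsBaseChange.equiv_tmul, map_smul]
    rfl

theorem reductionClass_congr_of_baseChange {M N : Type u} [AddCommGroup M] [Module A M]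
    [Module.Finite A M] [AddCommGroup N] [Module A N] [Module.Finite A N]
    (ρ : Representation A G M) (τ : Representation A G N) (e : K ⊗[A] M ≃ₗ[K] K ⊗[A] N)
    (he : ∀ s v, e (baseChangeRep K ρ s v) = baseChangeRep K τ s (e v)) :
    reductionClass ρ = reductionClass τ := by
  obtain ⟨ϖ, hϖ⟩ := IsDiscreteValuationRing.exists_irreducible A
  let o : Representation A G PUnit.{u + 1} := 1
  rw [reductionClass_eq_add_of_baseChange ρ τ o e.toLinearMap 0 he (fun s v => (map_zero _).symm) e.injective
    (fun x => ⟨fun _ => e.surjective x, fun _ => rfl⟩) (fun x => ⟨0, Subsingleton.elim _ _⟩),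
    reductionClass_of_smul_eq_zero hϖ.maximalIdeal_eq o fun _ => rfl, add_zero]

theorem reductionClass_of_free {Λ : Type u} [AddCommGroup Λ] [Module A Λ]
    [Module.Free A Λ] [Module.Finite A Λ] (ρ : Representation A G Λ) :
    reductionClass ρ = virtualClass (baseChangeRep (ResidueField A) ρ) := by
  obtain ⟨ϖ, hϖ⟩ := IsDiscreteValuationRing.exists_irreducible A
  have : Subsingleton (residueTorsion A Λ) := ⟨fun x y => by
    have h (z : residueTorsion A Λ) : (z : Λ) = 0 :=
      (smul_eq_zero_iff_right hϖ.ne_zero).1 ((mem_residueTorsion_iff hϖ.maximalIdeal_eq).1 z.2)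
    exact Subtype.ext ((h x).trans (h y).symm)⟩
  rw [reductionClass, virtualClass_of_subsingleton (residueTorsionRep ρ), sub_zero]

variable (A K G) in
/-- There is a decomposition homomorphism: reduction modulo the maximal ideal of the classes of
representations over the fraction field. -/
theorem exists_decomposition [Finite G] :
    ∃ d : VirtualModule K G →+ VirtualModule (ResidueField A) G,
      ∀ (M : Type u) [AddCommGroup M] [Module A M] [Module.Finite A M]
        (ρ : Representation A G M), d (virtualClass (baseChangeRep K ρ)) = reductionClass ρ := by
  -- On generators `d` is the reduction class of a chosen lattice. The choice does not matter, since
  -- reduction classes depend only on the representation over `K`.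
  choose Λ _ _ _ _ ρ e he using fun V : FDRep K G => exists_lattice (A := A) V.ρ
  let d₀ : FreeAbelianGroup (FDRep K G) →+ VirtualModule (ResidueField A) G :=
    FreeAbelianGroup.lift fun V => reductionClass (ρ V)
  have hd₀ : AddSubgroup.closure (exactRelations K G) ≤ d₀.ker := by
    rw [AddSubgroup.closure_le]
    rintro _ ⟨V₁, V₂, V₃, f, g, hf, hg, hinj, hex, hsurj, rfl⟩
    have he' (V : FDRep K G) (s : G) (v : V) :
        (e V).symm (V.ρ s v) = baseChangeRep K (ρ V) s ((e V).symm v) := by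
      rw [LinearEquiv.symm_apply_eq, he, LinearEquiv.apply_symm_apply]
    have h := reductionClass_eq_add_of_baseChange (ρ V₁) (ρ V₂) (ρ V₃)
      ((e V₂).symm.toLinearMap ∘ₗ f ∘ₗ (e V₁).toLinearMap)
      ((e V₃).symm.toLinearMap ∘ₗ g ∘ₗ (e V₂).toLinearMap)
      (fun s v => by
        simp only [LinearMap.comp_apply, LinearEquiv.coe_coe]
        rw [he, hf, he'])
      (fun s v => by
        simp only [LinearMap.comp_apply, LinearEquiv.coe_coe]
        rw [he, hg, he'])
      ((e V₂).symm.injective.comp (hinj.comp (e V₁).injective))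
      (fun x => by
        simp only [LinearMap.comp_apply, LinearEquiv.coe_coe]
        rw [map_eq_zero_iff _ (e V₃).symm.injective, hex]
        refine ⟨fun ⟨y, hy⟩ => ⟨(e V₁).symm y, ?_⟩, fun ⟨y, hy⟩ => ⟨e V₁ y, ?_⟩⟩
        · simp [hy]
        · simp [← hy])
      ((e V₃).symm.surjective.comp (hsurj.comp (e V₂).surjective))
    change d₀ _ = 0
    simp only [d₀, map_sub, FreeAbelianGroup.lift_apply_of]
    rw [h]
    abel
  refine ⟨QuotientAddGroup.lift _ d₀ hd₀, fun M _ _ _ τ => ?_⟩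
  have h : d₀ (FreeAbelianGroup.of (FDRep.of (baseChangeRep K τ))) = reductionClass τ := by
    rw [FreeAbelianGroup.lift_apply_of]
    exact reductionClass_congr_of_baseChange (K := K) _ τ (e _) (he _)
  exact h

/-- Reduction is a function on virtual modules. -/
theorem isReduction_iff [Finite G] (d : VirtualModule K G →+ VirtualModule (ResidueField A) G)
    (hd : ∀ (M : Type u) [AddCommGroup M] [Module A M] [Module.Finite A M]
        (ρ : Representation A G M), d (virtualClass (baseChangeRep K ρ)) = reductionClass ρ)
    (x : VirtualModule K G) (y : VirtualModule (ResidueField A) G) :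
    IsReduction A K x y ↔ y = d x := by
  constructor
  · intro h
    refine AddSubgroup.closure_induction (p := fun z _ => z.2 = d z.1) ?_ ?_ ?_ ?_ h
    · rintro _ ⟨Λ, _, _, _, _, ρ, rfl⟩
      rw [hd, reductionClass_of_free]
    · simp
    · intro a b _ _ ha hb
      simp [ha, hb]
    · intro a _ ha
      simp [ha]
  -- Classes of lattices generate all virtual `K[G]`-modules, so every pair `(x, d x)` is a
  -- combination of the defining pairs.
  · rintro rfl
    obtain ⟨x, rfl⟩ := QuotientAddGroup.mk_surjective x
    induction x using FreeAbelianGroup.induction_on with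
    | zero => rw [QuotientAddGroup.mk_zero, map_zero]; exact AddSubgroup.zero_mem _
    | of V =>
      obtain ⟨Λ, _, _, _, _, ρ, e, he⟩ := exists_lattice (A := A) V.ρ
      have h : virtualClass (baseChangeRep K ρ) =
          (QuotientAddGroup.mk (FreeAbelianGroup.of V) : VirtualModule K G) :=
        virtualClass_congr (baseChangeRep K ρ) V.ρ e.toLinearMap he e.bijective
      rw [← h]
      refine AddSubgroup.subset_closure ⟨Λ, _, _, inferInstance, inferInstance, ρ, ?_⟩
      rw [hd, reductionClass_of_free]
    | neg x hx => rw [QuotientAddGroup.mk_neg, map_neg]; exact AddSubgroup.neg_mem _ hx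
    | add x y hx hy => rw [QuotientAddGroup.mk_add, map_add]; exact AddSubgroup.add_mem _ hx hy

end Decomposition

/-! ### Eigenvalues in exact sequences -/

section Charpoly

variable {F : Type*} [Field F] {V₁ V₂ V₃ : Type*}
  [AddCommGroup V₁] [Module F V₁] [Module.Finite F V₁]
  [AddCommGroup V₂] [Module F V₂] [Module.Finite F V₂]
  [AddCommGroup V₃] [Module F V₃] [Module.Finite F V₃]

/-- The characteristic polynomial is multiplicative in short exact sequences. -/
theorem charpoly_eq_mul_of_exact (φ₁ : Module.End F V₁) (φ₂ : Module.End F V₂)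
    (φ₃ : Module.End F V₃) (f : V₁ →ₗ[F] V₂) (g : V₂ →ₗ[F] V₃)
    (hf : ∀ v, f (φ₁ v) = φ₂ (f v)) (hg : ∀ v, g (φ₂ v) = φ₃ (g v))
    (hinj : Function.Injective f) (hex : Function.Exact f g) (hsurj : Function.Surjective g) :
    φ₂.charpoly = φ₁.charpoly * φ₃.charpoly := by
  obtain ⟨s, hs⟩ := g.exists_rightInverse_of_surjective (LinearMap.range_eq_top.2 hsurj)
  have hs' (y : V₃) : g (s y) = y := LinearMap.congr_fun hs y
  have hgf (x : V₁) : g (f x) = 0 := (hex _).2 ⟨x, rfl⟩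
  let e : (V₁ × V₃) ≃ₗ[F] V₂ := LinearEquiv.ofBijective (f.coprod s) (by
    constructor
    · refine (injective_iff_map_eq_zero _).2 fun x hx => ?_
      rw [LinearMap.coprod_apply] at hx
      have h2 : x.2 = 0 := by simpa [hgf, hs'] using congrArg g hx
      rw [h2, map_zero, add_zero] at hx
      exact Prod.ext (hinj (hx.trans (map_zero f).symm)) h2
    · intro y
      obtain ⟨x, hx⟩ := (hex (y - s (g y))).1 (by rw [map_sub, hs', sub_self])
      exact ⟨(x, g y), by rw [LinearMap.coprod_apply, hx, sub_add_cancel]⟩)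
  have he (x : V₁ × V₃) : e x = f x.1 + s x.2 := rfl
  have hsnd (y : V₂) : (e.symm y).2 = g y := by
    obtain ⟨x, rfl⟩ := e.surjective y
    rw [LinearEquiv.symm_apply_apply, he, map_add, hgf, hs', zero_add]
  have hfst (x : V₁) : e.symm (f x) = (x, 0) := by
    rw [LinearEquiv.symm_apply_eq, he, map_zero, add_zero]
  let b₁ := Module.finBasis F V₁
  let b₃ := Module.finBasis F V₃
  let ψ : Module.End F (V₁ × V₃) := e.symm.conj φ₂
  have hψ (x : V₁ × V₃) : ψ x = e.symm (φ₂ (e x)) := rfl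
  let T := LinearMap.toMatrix (b₁.prod b₃) (b₁.prod b₃) ψ
  -- In a basis adapted to the vector space splitting, which need not be stable, the matrix is block
  -- upper triangular.
  have hT : T = Matrix.fromBlocks (LinearMap.toMatrix b₁ b₁ φ₁) T.toBlocks₁₂ 0
      (LinearMap.toMatrix b₃ b₃ φ₃) := by
    ext i j
    rcases i with i | i <;> rcases j with j | j
    · simp [T, LinearMap.toMatrix_apply, hψ, he, ← hf, hfst]
    · rfl
    · simp [T, LinearMap.toMatrix_apply, hψ, he, ← hf, hfst]
    · simp [T, LinearMap.toMatrix_apply, hψ, he, hsnd, hg, hs']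
  rw [← e.symm.charpoly_conj φ₂, ← LinearMap.charpoly_toMatrix ψ (b₁.prod b₃)]
  change T.charpoly = _
  rw [hT, Matrix.charpoly_fromBlocks_zero₂₁, LinearMap.charpoly_toMatrix,
    LinearMap.charpoly_toMatrix]

variable (E : Type*) [Field E] [Algebra F E]

theorem algebraMap_trace_eq_sum_aroots [IsAlgClosed E] (φ : Module.End F V₁) :
    algebraMap F E (LinearMap.trace F V₁ φ) = (φ.charpoly.aroots E).sum := by
  rw [← LinearMap.trace_baseChange, Module.End.trace_eq_sum_roots_charpoly_of_splits
    (IsAlgClosed.splits _), LinearMap.charpoly_baseChange]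

theorem pow_eq_one_of_mem_aroots_charpoly {φ : Module.End F V₁} {n : ℕ} (hφ : φ ^ n = 1) {z : E}
    (hz : z ∈ φ.charpoly.aroots E) : z ^ n = 1 := by
  have h1 : (LinearMap.baseChange E φ).charpoly.IsRoot z := by
    rw [LinearMap.charpoly_baseChange]
    exact Polynomial.isRoot_of_mem_roots hz
  obtain ⟨v, hv⟩ := ((Module.End.hasEigenvalue_iff_isRoot_charpoly _ _).2 h1).exists_hasEigenvector
  have h2 : LinearMap.baseChange E φ ^ n = 1 := by
    rw [← LinearMap.baseChange_pow, hφ]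
    exact LinearMap.baseChange_id
  have h3 := hv.pow_apply n
  rw [h2, Module.End.one_apply] at h3
  exact smul_left_injective E hv.2 (h3.symm.trans (one_smul E v).symm)

end Charpoly

section EigenvalueSum

variable {F : Type u} [Field F] {G : Type v} [Group G] {E : Type*} [Field E] [Algebra F E]
  {B : Type*} [AddCommGroup B]

/-- A sum over the eigenvalues of a group element is additive in short exact sequences. -/
theorem exists_eigenvalueSum (g : G) (t : E → B) :
    ∃ h : VirtualModule F G →+ B, ∀ (V : Type u) [AddCommGroup V] [Module F V] [Module.Finite F V]
      (ρ : Representation F G V),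
      h (virtualClass ρ) = (((ρ g).charpoly.aroots E).map t).sum := by
  let h₀ : FreeAbelianGroup (FDRep F G) →+ B :=
    FreeAbelianGroup.lift fun V => (((V.ρ g).charpoly.aroots E).map t).sum
  have hh₀ : AddSubgroup.closure (exactRelations F G) ≤ h₀.ker := by
    rw [AddSubgroup.closure_le]
    rintro _ ⟨V₁, V₂, V₃, f, f', hf, hf', hinj, hex, hsurj, rfl⟩
    have h := charpoly_eq_mul_of_exact (V₁.ρ g) (V₂.ρ g) (V₃.ρ g) f f' (hf g) (hf' g) hinj hex hsurj
    change h₀ _ = 0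
    simp only [h₀, map_sub, FreeAbelianGroup.lift_apply_of]
    rw [h, Polynomial.aroots_mul (mul_ne_zero (LinearMap.charpoly_monic _).ne_zero
      (LinearMap.charpoly_monic _).ne_zero), Multiset.map_add, Multiset.sum_add]
    abel
  refine ⟨QuotientAddGroup.lift _ h₀ hh₀, fun V _ _ _ ρ => ?_⟩
  have h : h₀ (FreeAbelianGroup.of (FDRep.of ρ)) = (((ρ g).charpoly.aroots E).map t).sum := by
    rw [FreeAbelianGroup.lift_apply_of]
    rfl
  exact h

end EigenvalueSum

/-! ### Teichmüller lifts and the Brauer character of a lattice -/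

section Teichmuller

variable {A : Type u} [CommRing A] [IsLocalRing A] {K : Type u} [Field K] [Algebra A K]

/-- Reduction is injective on roots of unity of order prime to `p`. For the quotient `u = z / w`,
with `uᴺ = 1` and `N = m * n`, `u ≠ 1` would give `1 + u + ⋯ + uᴺ⁻¹ = 0`; as `u` reduces to `1`,
this would say `N = 0` in characteristic `p`. Hence the choice in `teichmullerLift` is forced. -/
theorem eq_of_residue_eq {p : ℕ} [CharP (ResidueField A) p] [Fact p.Prime]
    (res : integralClosure A (AlgebraicClosure K) →ₐ[A] AlgebraicClosure (ResidueField A))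
    {z w : integralClosure A (AlgebraicClosure K)} {m n : ℕ} (hm : ¬ p ∣ m) (hn : ¬ p ∣ n)
    (hz : z ^ m = 1) (hw : w ^ n = 1) (h : res z = res w) : z = w := by
  have hn0 : n ≠ 0 := fun h => hn (h ▸ dvd_zero p)
  have hw' : w * w ^ (n - 1) = 1 := by rw [← pow_succ', Nat.sub_add_cancel (by omega), hw]
  let u := z * w ^ (n - 1)
  have hu : u ^ (m * n) = 1 := by
    rw [mul_pow, pow_mul, hz, one_pow, one_mul, ← pow_mul, mul_comm (n - 1), mul_assoc,
      mul_left_comm, pow_mul, hw, one_pow]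
  have hru : res u = 1 := by
    rw [map_mul, h, ← map_mul, hw', map_one]
  have hu1 : u = 1 := by
    by_contra hne
    have h1 := mul_geom_sum u (m * n)
    rw [hu, sub_self] at h1
    have h2 := congrArg res ((mul_eq_zero.1 h1).resolve_left (sub_ne_zero.2 hne))
    have : CharP (AlgebraicClosure (ResidueField A)) p :=
      charP_of_injective_algebraMap (algebraMap (ResidueField A) _).injective p
    rw [map_sum, map_zero] at h2
    simp only [map_pow, hru, one_pow, Finset.sum_const, Finset.card_range, nsmul_eq_mul,
      mul_one] at h2
    rw [CharP.cast_eq_zero_iff (AlgebraicClosure (ResidueField A)) p] at h2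
    exact ((Fact.out : p.Prime).dvd_mul.1 h2).elim hm hn
  calc z = z * (w * w ^ (n - 1)) := by rw [hw', mul_one]
    _ = u * w := by ring
    _ = w := by rw [hu1, one_mul]

theorem teichmullerLift_residue {p : ℕ} [CharP (ResidueField A) p] [Fact p.Prime]
    (res : integralClosure A (AlgebraicClosure K) →ₐ[A] AlgebraicClosure (ResidueField A))
    {z : integralClosure A (AlgebraicClosure K)} {n : ℕ} (hn : ¬ p ∣ n) (hz : z ^ n = 1) :
    teichmullerLift p res (res z) = z := by
  have h : ∃ z' : integralClosure A (AlgebraicClosure K),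
      (∃ n : ℕ, ¬ p ∣ n ∧ z' ^ n = 1) ∧ res z' = res z := ⟨z, ⟨n, hn, hz⟩, rfl⟩
  rw [teichmullerLift, dif_pos h]
  obtain ⟨⟨m, hm, hz'⟩, h'⟩ := h.choose_spec
  rw [eq_of_residue_eq res hm hn hz' hz h']

/-- A monic polynomial over `A` splits already over the integral closure, so applying `res` to the
factorization matches roots with multiplicity in both fields. -/
theorem exists_integral_roots
    (res : integralClosure A (AlgebraicClosure K) →ₐ[A] AlgebraicClosure (ResidueField A))
    {P : Polynomial A} (hP : P.Monic) :
    ∃ R : Multiset (integralClosure A (AlgebraicClosure K)),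
      P.aroots (AlgebraicClosure K) = R.map Subtype.val ∧
      P.aroots (AlgebraicClosure (ResidueField A)) = R.map res := by
  let O := integralClosure A (AlgebraicClosure K)
  have hint : ∀ z ∈ P.aroots (AlgebraicClosure K), z ∈ O := fun z hz =>
    ⟨P, hP, by simpa [Polynomial.IsRoot, Polynomial.eval_map] using Polynomial.isRoot_of_mem_roots hz⟩
  obtain ⟨R, hR⟩ : ∃ R : Multiset O, R.map Subtype.val = P.aroots (AlgebraicClosure K) :=
    ⟨(P.aroots (AlgebraicClosure K)).attach.map fun z => ⟨z.1, hint z.1 z.2⟩, by simp⟩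
  have hprod : P.map (algebraMap A O) = (R.map fun z => Polynomial.X - Polynomial.C z).prod := by
    refine Polynomial.map_injective (algebraMap O (AlgebraicClosure K)) Subtype.val_injective ?_
    rw [Polynomial.map_map, ← IsScalarTower.algebraMap_eq,
      (IsAlgClosed.splits (P.map (algebraMap A (AlgebraicClosure K)))).eq_prod_roots_of_monic
        (hP.map _), Polynomial.map_multiset_prod, Multiset.map_map]
    change ((P.aroots (AlgebraicClosure K)).map _).prod = _
    rw [← hR, Multiset.map_map]
    congr 1
    refine Multiset.map_congr rfl fun z _ => ?_
    simp
  refine ⟨R, hR.symm, ?_⟩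
  have h2 := congrArg (Polynomial.map res.toRingHom) hprod
  rw [Polynomial.map_map, Polynomial.map_multiset_prod, Multiset.map_map] at h2
  have h3 : res.toRingHom.comp (algebraMap A O) = algebraMap A _ := res.comp_algebraMap
  have h4 : P.map (algebraMap A (AlgebraicClosure (ResidueField A))) =
      ((R.map res).map fun z => Polynomial.X - Polynomial.C z).prod := by
    rw [← h3, h2, Multiset.map_map]
    congr 1
    refine Multiset.map_congr rfl fun z _ => ?_
    simp
  rw [Polynomial.aroots_def, h4, Polynomial.roots_multiset_prod_X_sub_C]

/-- The character of a lattice at a `p`-regular element is the Brauer character of its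
reduction. -/
theorem character_eq_brauerCharacter [IsDomain A] [IsFractionRing A K]
    {p : ℕ} [CharP (ResidueField A) p] [Fact p.Prime]
    (res : integralClosure A (AlgebraicClosure K) →ₐ[A] AlgebraicClosure (ResidueField A))
    {G : Type v} [Group G] {g : G} (hg : ¬ p ∣ orderOf g) {Λ : Type u} [AddCommGroup Λ] [Module A Λ]
    [Module.Free A Λ] [Module.Finite A Λ] (ρ : Representation A G Λ) :
    (((baseChangeRep K ρ g).charpoly.aroots (AlgebraicClosure K)).map id).sum =
      brauerCharacter p res (baseChangeRep (ResidueField A) ρ) g := by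
  obtain ⟨R, hR, hR'⟩ := exists_integral_roots (K := K) res (LinearMap.charpoly_monic (ρ g))
  have hK : (baseChangeRep K ρ g).charpoly.aroots (AlgebraicClosure K) = R.map Subtype.val := by
    rw [← hR]
    change (LinearMap.charpoly (LinearMap.baseChange K (ρ g))).aroots _ = _
    rw [LinearMap.charpoly_baseChange, Polynomial.aroots_map]
  have hk : (baseChangeRep (ResidueField A) ρ g).charpoly.aroots
      (AlgebraicClosure (ResidueField A)) = R.map res := by
    rw [← hR']
    change (LinearMap.charpoly (LinearMap.baseChange (ResidueField A) (ρ g))).aroots _ = _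
    rw [LinearMap.charpoly_baseChange, Polynomial.aroots_map]
  rw [brauerCharacter, hk, hK, Multiset.map_id, Multiset.map_map]
  congr 1
  -- It remains to see that each eigenvalue is a root of unity of order prime to `p`: its order
  -- divides `orderOf g`.
  refine Multiset.map_congr rfl fun z hz => (teichmullerLift_residue res hg ?_).symm
  refine Subtype.ext ?_
  have h1 : baseChangeRep K ρ g ^ orderOf g = 1 := by rw [← map_pow, pow_orderOf_eq_one, map_one]
  exact pow_eq_one_of_mem_aroots_charpoly (AlgebraicClosure K) h1
    (hK ▸ Multiset.mem_map_of_mem _ hz)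

end Teichmuller

theorem map_negOnePow_smul {X Y : Type*} [AddCommGroup X] [AddCommGroup Y] (φ : X →+ Y) (i : ℤ)
    (v : X) : φ (i.negOnePow • v) = i.negOnePow • φ v := by
  simp only [Units.smul_def, map_zsmul]

/-! ### Cohomology of the derived reduction -/

section Cohomology

variable {A : Type u} [CommRing A] [IsDomain A] [IsDiscreteValuationRing A]
  [HasDerivedCategory.{w} (ModuleCat.{u} A)]
  [HasDerivedCategory.{w'} (ModuleCat.{u} (ResidueField A))]
  {G : Type v} [Group G]

/-- The universal coefficient sequence for the derived reduction. -/
theorem exists_universalCoefficient_sequence (L : DerivedCategory (ModuleCat.{u} A))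
    (ρ : G →* End L) (i : ℤ) :
    ∃ (f : ResidueField A ⊗[A] cohomology L i →ₗ[ResidueField A]
        cohomology ((derivedBaseChange A (ResidueField A)).obj L) i)
      (g : cohomology ((derivedBaseChange A (ResidueField A)).obj L) i →ₗ[ResidueField A]
        residueTorsion A (cohomology L (i + 1))),
      (∀ s v, f (baseChangeRep (ResidueField A) (cohomologyRep ρ i) s v) =
        cohomologyRep (derivedBaseChangeAction (ResidueField A) ρ) i s (f v)) ∧
      (∀ s v, g (cohomologyRep (derivedBaseChangeAction (ResidueField A) ρ) i s v) =
        residueTorsionRep (cohomologyRep ρ (i + 1)) s (g v)) ∧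
      Function.Injective f ∧ Function.Exact f g ∧ Function.Surjective g := by
  obtain ⟨ϖ, hirr⟩ := IsDiscreteValuationRing.exists_irreducible A
  have hϖ := hirr.maximalIdeal_eq
  obtain ⟨a, b, h1, h2, h3, h4⟩ := exists_cohomology_reduction_sequence hϖ
    (mem_nonZeroDivisors_of_ne_zero hirr.ne_zero) L i
  let Y : Type u := cohomology ((derivedBaseChange A (ResidueField A)).obj L) i
  let _ : Module A Y := Module.compHom Y (algebraMap A (ResidueField A))
  have : IsScalarTower A (ResidueField A) Y := IsScalarTower.of_algebraMap_smul fun _ _ => rfl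
  let a' : cohomology L i →ₗ[A] Y := a.hom
  let b' : Y →ₗ[A] cohomology L (i + 1) := b.hom
  -- The sequence over `A` becomes `k`-linear: `a` extends to the tensor product by adjunction, and
  -- `b` lands in the part killed by `ϖ`, where `A`-linearity is `k`-linearity since the residue map
  -- is surjective.
  let f : ResidueField A ⊗[A] cohomology L i →ₗ[ResidueField A] Y :=
    LinearMap.liftBaseChange (ResidueField A) a'
  have hf (x : cohomology L i) : f ((1 : ResidueField A) ⊗ₜ x) = a' x := by
    rw [LinearMap.liftBaseChange_tmul, one_smul]
  let g : Y →ₗ[ResidueField A] residueTorsion A (cohomology L (i + 1)) :=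
    (b'.codRestrict (residueTorsion A (cohomology L (i + 1))) fun z =>
      (mem_residueTorsion_iff hϖ).2 ((h3 _).2 ⟨z, rfl⟩)).extendScalarsOfSurjective
        residue_surjective
  have hg (z : Y) : (g z : cohomology L (i + 1)) = b' z := rfl
  refine ⟨f, g, fun s v => ?_, fun s v => ?_, ?_, fun z => ?_, fun y => ?_⟩
  · obtain ⟨x, rfl⟩ := one_tmul_surjective _ v
    change f ((1 : ResidueField A) ⊗ₜ (cohomologyRep ρ i s x)) = _
    rw [hf]
    refine Eq.trans ?_ (congrArg _ (hf x).symm)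
    exact ConcreteCategory.congr_hom (h4 (ρ s)).1 x
  · have h5 := ConcreteCategory.congr_hom (h4 (ρ s)).2 (show Y from v)
    exact Subtype.ext h5
  · refine (injective_iff_map_eq_zero _).2 fun v hv => ?_
    obtain ⟨x, rfl⟩ := one_tmul_surjective _ v
    exact (one_tmul_eq_zero_iff hϖ x).2 ((h1 x).1 ((hf x).symm.trans hv))
  · rw [Subtype.ext_iff]
    refine (h2 z).trans ⟨fun ⟨x, hx⟩ => ⟨_, (hf x).trans hx⟩, fun ⟨v, hv⟩ => ?_⟩
    obtain ⟨x, rfl⟩ := one_tmul_surjective _ v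
    exact ⟨x, (hf x).symm.trans hv⟩
  · obtain ⟨z, hz⟩ := (h3 y).1 ((mem_residueTorsion_iff hϖ).1 y.2)
    exact ⟨z, Subtype.ext hz⟩

/-- The module is an extension of finite ones by the universal coefficient sequence. No action is
involved, so the sequence is taken for the trivial group `Unit`. -/
theorem finite_cohomology_derivedBaseChange (L : DerivedCategory (ModuleCat.{u} A))
    (hfg : ∀ i : ℤ, Module.Finite A (cohomology L i)) (i : ℤ) :
    Module.Finite (ResidueField A)
      (cohomology ((derivedBaseChange A (ResidueField A)).obj L) i) := by
  obtain ⟨f, g, -, -, -, hex, -⟩ :=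
    exists_universalCoefficient_sequence L (1 : Unit →* End L) i
  have := hfg i
  have := hfg (i + 1)
  have := isNoetherian_of_range_eq_ker f g (LinearMap.exact_iff.1 hex).symm
  infer_instance

theorem subsingleton_cohomology_derivedBaseChange (L : DerivedCategory (ModuleCat.{u} A)) (i : ℤ)
    [Subsingleton (cohomology L i)] [Subsingleton (cohomology L (i + 1))] :
    Subsingleton (cohomology ((derivedBaseChange A (ResidueField A)).obj L) i) := by
  obtain ⟨f, g, -, -, -, hex, -⟩ :=
    exists_universalCoefficient_sequence L (1 : Unit →* End L) i
  refine subsingleton_of_forall_eq 0 fun x => ?_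
  obtain ⟨y, rfl⟩ := (hex x).1 (Subsingleton.elim _ _)
  rw [Subsingleton.elim y 0, map_zero]

theorem subsingleton_cohomology {R : Type u} [CommRing R]
    [HasDerivedCategory.{w} (ModuleCat.{u} R)] {L : DerivedCategory (ModuleCat.{u} R)}
    (htor : HasFiniteTorDimension L) :
    ∃ a b : ℤ, ∀ i, i < a ∨ b < i → Subsingleton (cohomology L i) := by
  obtain ⟨F, a, b, -, hF, ⟨e⟩⟩ := htor
  refine ⟨a, b, fun i hi => ?_⟩
  have h1 : Limits.IsZero (F.homology i) :=
    (F.exactAt_iff_isZero_homology i).1 (ShortComplex.exact_of_isZero_X₂ _ (hF i hi))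
  exact ModuleCat.subsingleton_of_isZero (h1.of_iso
    ((DerivedCategory.homologyFunctor _ i).mapIso e.symm ≪≫
      (DerivedCategory.homologyFunctorFactors (ModuleCat.{u} R) i).app F))

theorem virtualClass_cohomology_derivedBaseChange {L : DerivedCategory (ModuleCat.{u} A)}
    (ρ : G →* End L) (i : ℤ) [Module.Finite A (cohomology L i)]
    [Module.Finite A (cohomology L (i + 1))]
    [Module.Finite (ResidueField A)
      (cohomology ((derivedBaseChange A (ResidueField A)).obj L) i)] :
    virtualClass (cohomologyRep (derivedBaseChangeAction (ResidueField A) ρ) i) =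
      virtualClass (baseChangeRep (ResidueField A) (cohomologyRep ρ i)) +
        virtualClass (residueTorsionRep (cohomologyRep ρ (i + 1))) := by
  obtain ⟨f, g, hf, hg, hinj, hex, hsurj⟩ := exists_universalCoefficient_sequence L ρ i
  exact virtualClass_eq_add _ _ _ f g hf hg hinj hex hsurj

/-- The alternating sum of the cohomology of the derived reduction. -/
theorem finsum_virtualClass_derivedBaseChange {L : DerivedCategory (ModuleCat.{u} A)}
    (htor : HasFiniteTorDimension L) (ρ : G →* End L) [∀ i : ℤ, Module.Finite A (cohomology L i)]
    [∀ i : ℤ, Module.Finite (ResidueField A)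
      (cohomology ((derivedBaseChange A (ResidueField A)).obj L) i)] :
    ∑ᶠ i : ℤ, i.negOnePow • virtualClass
        (cohomologyRep (derivedBaseChangeAction (ResidueField A) ρ) i) =
      ∑ᶠ i : ℤ, i.negOnePow • reductionClass (cohomologyRep ρ i) := by
  obtain ⟨a, b, hab⟩ := subsingleton_cohomology htor
  let x (i : ℤ) : VirtualModule (ResidueField A) G :=
    i.negOnePow • virtualClass (baseChangeRep (ResidueField A) (cohomologyRep ρ i))
  let y (i : ℤ) : VirtualModule (ResidueField A) G :=
    i.negOnePow • virtualClass (residueTorsionRep (cohomologyRep ρ i))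
  have hx : x.support.Finite := (Set.finite_Icc a b).subset fun i hi => by
    by_contra h
    have := hab i (by rw [Set.mem_Icc] at h; omega)
    exact hi (by simp only [x]; rw [virtualClass_of_subsingleton, smul_zero])
  have hy : y.support.Finite := (Set.finite_Icc a b).subset fun i hi => by
    by_contra h
    have := hab i (by rw [Set.mem_Icc] at h; omega)
    exact hi (by simp only [y]; rw [virtualClass_of_subsingleton, smul_zero])
  -- Degree `i` of the reduction contains the torsion of degree `i + 1`. The shift flips the sign,
  -- which turns the plus sign into the minus sign of `reductionClass`, and reindexing `ℤ` absorbs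
  -- it.
  let y' (i : ℤ) : VirtualModule (ResidueField A) G := y (i + 1)
  have hy' : y'.support.Finite := hy.preimage (f := fun i : ℤ => i + 1)
    (add_left_injective 1).injOn
  have e1 (i : ℤ) : i.negOnePow • virtualClass
      (cohomologyRep (derivedBaseChangeAction (ResidueField A) ρ) i) = x i - y' i := by
    rw [virtualClass_cohomology_derivedBaseChange, smul_add, sub_eq_add_neg]
    congr 1
    simp only [y', y, Int.negOnePow_succ]
    rw [Units.neg_smul, neg_neg]
  have e2 (i : ℤ) : i.negOnePow • reductionClass (cohomologyRep ρ i) = x i - y i := by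
    rw [reductionClass, smul_sub]
  rw [finsum_congr e1, finsum_congr e2, finsum_sub_distrib hx hy', finsum_sub_distrib hx hy]
  congr 1
  exact finsum_comp_equiv (f := y) (Equiv.addRight (1 : ℤ))

end Cohomology

end PerfectReduction

/-! ### Assembly of the theorem -/

theorem mainTheorem2 {A : Type u} [CommRing A] [IsDomain A] [IsDiscreteValuationRing A]
    [IsAdicComplete (maximalIdeal A) A]
    (p : ℕ) [Fact p.Prime] [CharP (ResidueField A) p] [PerfectField (ResidueField A)]
    (K : Type u) [Field K] [Algebra A K] [IsFractionRing A K] [CharZero K]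
    [HasDerivedCategory.{w} (ModuleCat.{u} A)]
    [HasDerivedCategory.{w'} (ModuleCat.{u} (ResidueField A))]
    {G : Type v} [Group G] [Finite G]
    (L : DerivedCategory (ModuleCat.{u} A))
    (htor : HasFiniteTorDimension L) (hfg : ∀ i : ℤ, Module.Finite A (cohomology L i))
    (ρ : G →* End L) :
    ∃ (_ : ∀ i : ℤ, Module.Finite K (K ⊗[A] cohomology L i))
      (_ : ∀ i : ℤ, Module.Finite (ResidueField A)
        (cohomology ((derivedBaseChange A (ResidueField A)).obj L) i)),
      {i : ℤ | Nontrivial (K ⊗[A] cohomology L i)}.Finite ∧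
      {i : ℤ | Nontrivial (cohomology ((derivedBaseChange A (ResidueField A)).obj L) i)}.Finite ∧
      (∀ y : VirtualModule (ResidueField A) G,
        IsReduction A K
          (∑ᶠ i : ℤ, i.negOnePow • virtualClass (baseChangeRep K (cohomologyRep ρ i))) y ↔
        y = ∑ᶠ i : ℤ, i.negOnePow •
          virtualClass (cohomologyRep (derivedBaseChangeAction (ResidueField A) ρ) i)) ∧
      (∀ (res : integralClosure A (AlgebraicClosure K) →ₐ[A] AlgebraicClosure (ResidueField A))
        (g : G), ¬ p ∣ orderOf g →
        algebraMap K (AlgebraicClosure K)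
          (∑ᶠ i : ℤ, i.negOnePow • (baseChangeRep K (cohomologyRep ρ i)).character g) =
        ∑ᶠ i : ℤ, i.negOnePow •
          brauerCharacter p res (cohomologyRep (derivedBaseChangeAction (ResidueField A) ρ) i) g) := by
  have hK : ∀ i : ℤ, Module.Finite K (K ⊗[A] cohomology L i) := fun i => inferInstance
  have hk := finite_cohomology_derivedBaseChange L hfg
  obtain ⟨a, b, hab⟩ := subsingleton_cohomology htor
  have hK0 (i : ℤ) (hi : i ∉ Set.Icc a b) : Subsingleton (K ⊗[A] cohomology L i) := by
    have := hab i (by rw [Set.mem_Icc] at hi; omega)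
    infer_instance
  -- The range starts at `a - 1` because degree `i` of the reduction also sees `Hⁱ⁺¹(L)`.
  have hk0 (i : ℤ) (hi : i ∉ Set.Icc (a - 1) b) :
      Subsingleton (cohomology ((derivedBaseChange A (ResidueField A)).obj L) i) := by
    have := hab i (by rw [Set.mem_Icc] at hi; omega)
    have := hab (i + 1) (by rw [Set.mem_Icc] at hi; omega)
    exact subsingleton_cohomology_derivedBaseChange L i
  let x (i : ℤ) : VirtualModule K G :=
    i.negOnePow • virtualClass (baseChangeRep K (cohomologyRep ρ i))
  let y (i : ℤ) : VirtualModule (ResidueField A) G :=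
    i.negOnePow • virtualClass (cohomologyRep (derivedBaseChangeAction (ResidueField A) ρ) i)
  -- `∑ᶠ` is zero by convention on infinite supports, so finiteness is needed before additive maps
  -- can be moved inside.
  have hx : x.support.Finite := (Set.finite_Icc a b).subset fun i hi => by
    by_contra h
    have := hK0 i h
    exact hi (by simp only [x]; rw [virtualClass_of_subsingleton, smul_zero])
  have hy : y.support.Finite := (Set.finite_Icc (a - 1) b).subset fun i hi => by
    by_contra h
    have := hk0 i h
    exact hi (by simp only [y]; rw [virtualClass_of_subsingleton, smul_zero])
  obtain ⟨d, hd⟩ := exists_decomposition A K G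
  have hdx : d (∑ᶠ i, x i) = ∑ᶠ i, y i := by
    rw [finsum_virtualClass_derivedBaseChange htor ρ, AddMonoidHom.map_finsum d hx]
    refine finsum_congr fun i => ?_
    rw [map_negOnePow_smul, hd]
  refine ⟨hK, hk, (Set.finite_Icc a b).subset fun i hi => ?_,
    (Set.finite_Icc (a - 1) b).subset fun i hi => ?_, fun z => ?_, fun res g hg => ?_⟩
  · by_contra h
    exact not_nontrivial_iff_subsingleton.2 (hK0 i h) hi
  · by_contra h
    exact not_nontrivial_iff_subsingleton.2 (hk0 i h) hi
  · rw [isReduction_iff d hd]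
    exact Eq.congr_right hdx
  · obtain ⟨χ, hχ⟩ := exists_eigenvalueSum (F := K) g (id : AlgebraicClosure K → AlgebraicClosure K)
    obtain ⟨β, hβ⟩ := exists_eigenvalueSum (F := ResidueField A) g (teichmullerLift (K := K) p res)
    -- Both sides are additive in `v`, so the comparison reduces to a lattice, where it is
    -- `character_eq_brauerCharacter`.
    have hχβ (v : VirtualModule K G) : χ v = β (d v) := by
      obtain ⟨v, rfl⟩ := QuotientAddGroup.mk_surjective v
      induction v using FreeAbelianGroup.induction_on with
      | zero => simp
      | of V =>
        obtain ⟨Λ, _, _, _, _, τ, e, he⟩ := exists_lattice (A := A) V.ρ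
        have h : virtualClass (baseChangeRep K τ) =
            (QuotientAddGroup.mk (FreeAbelianGroup.of V) : VirtualModule K G) :=
          virtualClass_congr (baseChangeRep K τ) V.ρ e.toLinearMap he e.bijective
        rw [← h, hd, reductionClass_of_free, hχ, hβ]
        exact character_eq_brauerCharacter res hg τ
      | neg v hv => rw [QuotientAddGroup.mk_neg, map_neg, map_neg, map_neg, hv]
      | add v w hv hw => rw [QuotientAddGroup.mk_add, map_add, map_add, map_add, hv, hw]
    have h1 : algebraMap K (AlgebraicClosure K)
        (∑ᶠ i : ℤ, i.negOnePow • (baseChangeRep K (cohomologyRep ρ i)).character g) =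
        χ (∑ᶠ i, x i) := by
      rw [AddMonoidHom.map_finsum χ hx]
      -- The trace, viewed in the algebraic closure, is the sum of the eigenvalues, that is, the
      -- value of `χ`.
      refine (AddMonoidHom.map_finsum (algebraMap K (AlgebraicClosure K)).toAddMonoidHom
        ((Set.finite_Icc a b).subset fun i hi => ?_)).trans (finsum_congr fun i => ?_)
      · by_contra h
        have := hK0 i h
        refine hi ?_
        simp only [Representation.character]
        rw [Subsingleton.elim (baseChangeRep K (cohomologyRep ρ i) g) 0, map_zero, smul_zero]
      · rw [map_negOnePow_smul, map_negOnePow_smul, hχ, Multiset.map_id]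
        congr 1
        exact algebraMap_trace_eq_sum_aroots (AlgebraicClosure K)
          (baseChangeRep K (cohomologyRep ρ i) g)
    rw [h1, hχβ, hdx, AddMonoidHom.map_finsum β hy]
    refine finsum_congr fun i => ?_
    rw [map_negOnePow_smul, hβ]
    rfl
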